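/- Let $\Delta\subset\mathbb{R}^n$ be a root system: a finite set of nonzero vectors spanning $\mathbb{R}^n$ such that $\Delta\cap\mathbb{R}\alpha=\{\alpha,-\alpha\}$ for every $\alpha\in\Delta$ and $r_\alpha(\beta)\in\Delta$ for all $\alpha,\beta\in\Delta$, where $r_\alpha(x)=x-\frac{2(x,\alpha)}{(\alpha,\alpha)}\alpha$. Let $W$ be the finite reflection group generated by the $r_\alpha$, $\alpha\in\Delta$. Let $\Pi=\{\alpha_1,\dots,\alpha_n\}\subset\Delta$ be a simple system, i.e. a basis of $\mathbb{R}^n$ in which the coefficients of each root all have the same sign. Let $\alpha_1^*,\dots,\alpha_n^*$ be the dual basis, $(\alpha_i,\alpha_j^*)=\delta_{ij}$, and let $C(\Pi)=\{x\in\mathbb{R}^n : (x,\alpha_i)\ge 0,\ i=1,\dots,n\}$. Let $a_1,\dots,a_n>1$, let $A$ be the linear map with $A\alpha_j^*=a_j\alpha_j^*$ for all $j$, let $B=A^T$, and put $\mathcal{D}=\{B^k w : k\in\mathbb{Z},\ w\in W\}\subset GL(n,\mathbb{R})$. Let $\Gamma=G\mathbb{Z}^n$, where $G$ is a real $n\times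 n$ matrix with $\det G=1$. Then there exists a $(\mathcal{D},\Gamma)$-wavelet set $\Omega\subset C(\Pi)$. That is, there are a measurable set $\Omega\subset C(\Pi)$ and a function $\psi\in L^2(\mathbb{R}^n)$ with $\mathcal{F}(\psi)=\chi_\Omega$ almost everywhere, where $\mathcal{F}$ is the $L^2$ Fourier transform with kernel $e^{-2\pi i(x,\xi)}$, such that the family $x\mapsto|\det d|^{1/2}\,\psi(dx+t)$, $d\in\mathcal{D}$, $t\in\Gamma$, is an orthonormal basis of $L^2(\mathbb{R}^n)$. -/

import Mathlib

open MeasureTheory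
open scoped InnerProductSpace

/-- A root system in `ℝⁿ`: a finite set of nonzero vectors that spans `ℝⁿ`, contains exactly
`α` and `-α` on the line through each of its members `α`, and is stable under the orthogonal
reflections `r_α` in the hyperplanes `α^⊥`. (No crystallographic condition is imposed.) -/
structure IsEuclideanRootSystem {n : ℕ} (Δ : Set (EuclideanSpace ℝ (Fin n))) : Prop where
  finite : Δ.Finite
  ne_zero : ∀ α ∈ Δ, α ≠ 0
  span_eq_top : Submodule.span ℝ Δ = ⊤
  inter_line : ∀ α ∈ Δ, Δ ∩ (Submodule.span ℝ {α} : Set (EuclideanSpace ℝ (Fin n))) = {α, -α}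
  reflection_mem : ∀ α ∈ Δ, ∀ β ∈ Δ, (Submodule.span ℝ {α})ᗮ.reflection β ∈ Δ

/-- The reflection `r_α` really is `x ↦ x - 2 (x, α) / (α, α) α`. -/
theorem reflection_span_singleton_orthogonal_apply {n : ℕ} (α x : EuclideanSpace ℝ (Fin n)) :
    (Submodule.span ℝ {α})ᗮ.reflection x = x - (2 * ⟪x, α⟫_ℝ / ⟪α, α⟫_ℝ) • α := by
  rw [Submodule.reflection_orthogonal_apply, Submodule.reflection_singleton_apply,
    real_inner_self_eq_norm_sq, real_inner_comm, neg_sub, two_smul, ← add_smul]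
  simp only [RCLike.ofReal_real_eq_id, id_eq]
  congr 2
  ring

/-- The vectors `α₁, …, αₙ` form a simple system of the root system `Δ`: they are roots, they are
a basis of `ℝⁿ`, and all coefficients of any root in this basis have the same sign. -/
structure IsSimpleSystem {n : ℕ} (Δ : Set (EuclideanSpace ℝ (Fin n)))
    (α : Module.Basis (Fin n) ℝ (EuclideanSpace ℝ (Fin n))) : Prop where
  mem : ∀ i, α i ∈ Δ
  same_sign : ∀ β ∈ Δ, (∀ i, 0 ≤ α.repr β i) ∨ (∀ i, α.repr β i ≤ 0)

/-- The finite reflection group `W(Δ)`, generated by the reflections `r_α`, `α ∈ Δ`, as a subgroup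
of `GL(n, ℝ)`. -/
noncomputable def reflectionGroup {n : ℕ} (Δ : Set (EuclideanSpace ℝ (Fin n))) :
    Subgroup (EuclideanSpace ℝ (Fin n) ≃ₗ[ℝ] EuclideanSpace ℝ (Fin n)) :=
  Subgroup.closure {r | ∃ α ∈ Δ, r = (Submodule.span ℝ {α})ᗮ.reflection.toLinearEquiv}

/-- The closed convex cone `C(Π) = {x | (x, α) ≥ 0 for all α ∈ Π}`, `Π = {α₁, …, αₙ}`. -/
def fundamentalCone {n : ℕ} (α : Fin n → EuclideanSpace ℝ (Fin n)) :
    Set (EuclideanSpace ℝ (Fin n)) :=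
  {x | ∀ i, 0 ≤ ⟪x, α i⟫_ℝ}

/-- The dilation set `{B^k | k ∈ ℤ} W`. -/
def dilationSet {n : ℕ} (B : EuclideanSpace ℝ (Fin n) ≃ₗ[ℝ] EuclideanSpace ℝ (Fin n))
    (W : Subgroup (EuclideanSpace ℝ (Fin n) ≃ₗ[ℝ] EuclideanSpace ℝ (Fin n))) :
    Set (EuclideanSpace ℝ (Fin n) ≃ₗ[ℝ] EuclideanSpace ℝ (Fin n)) :=
  {d | ∃ k : ℤ, ∃ w ∈ W, d = B ^ k * w}

/-- The lattice `G ℤⁿ` in `ℝⁿ`. -/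
def latticeOf {n : ℕ} (G : Matrix (Fin n) (Fin n) ℝ) : Set (EuclideanSpace ℝ (Fin n)) :=
  Set.range fun z : Fin n → ℤ => WithLp.toLp 2 (G.mulVec fun i => (z i : ℝ))

/-- `ψ ∈ L²(ℝⁿ)` is a `(D, T)`-wavelet: the functions `x ↦ |det d|^{1/2} ψ(d x + t)`, `d ∈ D`,
`t ∈ T`, form an orthonormal (Hilbert) basis of `L²(ℝⁿ)`. -/
def IsWavelet {n : ℕ} (D : Set (EuclideanSpace ℝ (Fin n) ≃ₗ[ℝ] EuclideanSpace ℝ (Fin n)))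
    (T : Set (EuclideanSpace ℝ (Fin n)))
    (ψ : Lp ℂ 2 (volume : Measure (EuclideanSpace ℝ (Fin n)))) : Prop :=
  ∃ b : HilbertBasis (D × T) ℂ (Lp ℂ 2 (volume : Measure (EuclideanSpace ℝ (Fin n)))),
    ∀ (d : D) (t : T),
      (b (d, t) : EuclideanSpace ℝ (Fin n) → ℂ) =ᵐ[volume] fun x =>
        (Real.sqrt |LinearMap.det (d.1 : EuclideanSpace ℝ (Fin n) →ₗ[ℝ] EuclideanSpace ℝ (Fin n))|
          : ℂ) * ψ (d.1 x + t.1)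

/-- `Ω` is a `(D, T)`-wavelet set: `Ω` is measurable and its indicator function is the `L²` Fourier
transform (with kernel `exp (-2πi (x, ξ))`) of a `(D, T)`-wavelet. -/
def IsWaveletSet {n : ℕ} (D : Set (EuclideanSpace ℝ (Fin n) ≃ₗ[ℝ] EuclideanSpace ℝ (Fin n)))
    (T : Set (EuclideanSpace ℝ (Fin n))) (Ω : Set (EuclideanSpace ℝ (Fin n))) : Prop :=
  MeasurableSet Ω ∧
    ∃ ψ : Lp ℂ 2 (volume : Measure (EuclideanSpace ℝ (Fin n))), IsWavelet D T ψ ∧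
      (Lp.fourierTransformₗᵢ (EuclideanSpace ℝ (Fin n)) ℂ ψ : EuclideanSpace ℝ (Fin n) → ℂ)
        =ᵐ[volume] Ω.indicator fun _ => (1 : ℂ)

/-! On the Fourier side the dilate and translate indexed by `(d, t)` is `|det d|^{-1/2}` times the
character `e^{2πi(η,t)}` cut off to `Ω`, evaluated at `η = d⁻ᵀξ`. These functions form an
orthonormal basis once `Ω` is an exact set of representatives modulo the dual lattice (so the
characters are a basis of `L²(Ω)`) and the preimages of `Ω` under the `d⁻ᵀ` partition space almost
everywhere: `isWaveletSet_of_tiling`.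

For `d = B^k w` one has `d⁻ᵀ = A^{-k} w`, since `w` is orthogonal. The chambers of `W` tile space up
to null sets (`exists_mem_fundamentalCone`, `eq_one_of_mem_chamber`). In the coordinates `(x, α_j)`
the cone is the positive orthant and `A` is diagonal with entries `a_j > 1`. It therefore suffices
to find `Ω` in the orthant that meets every nonzero `A`-orbit once and represents the torus exactly:
`exists_orthant_tile`.

A shell `F` between the unit cube and its dilate meets each orbit once. A strongly contracted copy
of `F` injects into the torus, and a strongly expanded copy contains a full cell. A measurable
Schröder–Bernstein argument cuts `F` into two pieces, one to be contracted and one to be expanded,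
whose images together represent the torus exactly. Moving pieces along orbits preserves the tiling.
-/

/-! ### Reflections, root systems and chambers -/

section RootSystems

variable {n : ℕ} {Δ : Set (EuclideanSpace ℝ (Fin n))}
  {α : Module.Basis (Fin n) ℝ (EuclideanSpace ℝ (Fin n))}

/-- The orthogonal reflection in the hyperplane `β^⊥`, as a linear equivalence. -/
noncomputable def rootReflection (β : EuclideanSpace ℝ (Fin n)) :
    EuclideanSpace ℝ (Fin n) ≃ₗ[ℝ] EuclideanSpace ℝ (Fin n) :=
  (Submodule.span ℝ {β})ᗮ.reflection.toLinearEquiv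

theorem rootReflection_apply (β x : EuclideanSpace ℝ (Fin n)) :
    rootReflection β x = x - (2 * ⟪x, β⟫_ℝ / ⟪β, β⟫_ℝ) • β :=
  reflection_span_singleton_orthogonal_apply β x

theorem inner_rootReflection (β x y : EuclideanSpace ℝ (Fin n)) :
    ⟪rootReflection β x, rootReflection β y⟫_ℝ = ⟪x, y⟫_ℝ :=
  (Submodule.span ℝ {β})ᗮ.reflection.inner_map_map x y

theorem rootReflection_mul_self (β : EuclideanSpace ℝ (Fin n)) :
    rootReflection β * rootReflection β = 1 := by
  ext1 x
  exact (Submodule.span ℝ {β})ᗮ.reflection_reflection x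

theorem rootReflection_self (β : EuclideanSpace ℝ (Fin n)) : rootReflection β β = -β := by
  rw [rootReflection_apply]
  by_cases h : β = 0
  · simp [h]
  · rw [mul_div_assoc, div_self (inner_self_ne_zero.2 h), mul_one, two_smul]
    abel

theorem conj_rootReflection (g : EuclideanSpace ℝ (Fin n) ≃ₗ[ℝ] EuclideanSpace ℝ (Fin n))
    (hg : ∀ x y, ⟪g x, g y⟫_ℝ = ⟪x, y⟫_ℝ) (β : EuclideanSpace ℝ (Fin n)) :
    rootReflection (g β) = g * rootReflection β * g⁻¹ := by
  ext1 x
  obtain ⟨y, rfl⟩ := g.surjective x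
  have : g⁻¹ (g y) = y := g.symm_apply_apply y
  simp only [LinearEquiv.mul_apply, this, rootReflection_apply, map_sub, map_smul, hg]

theorem rootReflection_mem_reflectionGroup {β : EuclideanSpace ℝ (Fin n)} (hβ : β ∈ Δ) :
    rootReflection β ∈ reflectionGroup Δ :=
  Subgroup.subset_closure ⟨β, hβ, rfl⟩

theorem inner_reflectionGroup {w : EuclideanSpace ℝ (Fin n) ≃ₗ[ℝ] EuclideanSpace ℝ (Fin n)}
    (hw : w ∈ reflectionGroup Δ) (x y : EuclideanSpace ℝ (Fin n)) : ⟪w x, w y⟫_ℝ = ⟪x, y⟫_ℝ := by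
  induction hw using Subgroup.closure_induction generalizing x y with
  | mem r hr =>
    obtain ⟨β, -, rfl⟩ := hr
    exact inner_rootReflection β x y
  | one => rfl
  | mul g h _ _ ihg ihh => rw [LinearEquiv.mul_apply, LinearEquiv.mul_apply, ihg, ihh]
  | inv g _ ih =>
    have h1 : ∀ z, g (g⁻¹ z) = z := fun z => g.apply_symm_apply z
    rw [← ih, h1, h1]

namespace IsEuclideanRootSystem

variable (hΔ : IsEuclideanRootSystem Δ)
include hΔ

theorem rootReflection_mem {β γ : EuclideanSpace ℝ (Fin n)} (hβ : β ∈ Δ) (hγ : γ ∈ Δ) :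
    rootReflection β γ ∈ Δ :=
  hΔ.reflection_mem β hβ γ hγ

theorem neg_mem {β : EuclideanSpace ℝ (Fin n)} (hβ : β ∈ Δ) : -β ∈ Δ := by
  rw [← rootReflection_self]
  exact hΔ.rootReflection_mem hβ hβ

theorem reflectionGroup_apply_mem
    {w : EuclideanSpace ℝ (Fin n) ≃ₗ[ℝ] EuclideanSpace ℝ (Fin n)} (hw : w ∈ reflectionGroup Δ)
    {β : EuclideanSpace ℝ (Fin n)} (hβ : β ∈ Δ) : w β ∈ Δ := by
  -- Stability under `w⁻¹` is carried along so that the inverse case of the induction closes.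
  have key : (∀ β ∈ Δ, w β ∈ Δ) ∧ (∀ β ∈ Δ, w⁻¹ β ∈ Δ) := by
    clear hβ
    induction hw using Subgroup.closure_induction with
    | mem r hr =>
      obtain ⟨γ, hγ, rfl⟩ := hr
      refine ⟨fun β hβ => hΔ.rootReflection_mem hγ hβ, fun β hβ => ?_⟩
      have : (rootReflection γ)⁻¹ = rootReflection γ :=
        inv_eq_of_mul_eq_one_left (rootReflection_mul_self γ)
      change (rootReflection γ)⁻¹ β ∈ Δ
      rw [this]
      exact hΔ.rootReflection_mem hγ hβ
    | one => exact ⟨fun β hβ => hβ, fun β hβ => hβ⟩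
    | mul g h _ _ ihg ihh =>
      refine ⟨fun β hβ => ihg.1 _ (ihh.1 _ hβ), fun β hβ => ?_⟩
      rw [mul_inv_rev]
      exact ihh.2 _ (ihg.2 _ hβ)
    | inv g _ ih => exact ⟨ih.2, by simpa using ih.1⟩
  exact key.1 β hβ

/-- Roots span, so an element of `W` is determined by the self-map of the finite set `Δ` that it
induces. -/
theorem finite_reflectionGroup : Finite (reflectionGroup Δ) := by
  have := hΔ.finite.to_subtype
  let f : reflectionGroup Δ → Δ → Δ :=
    fun w β => ⟨w.1 β.1, hΔ.reflectionGroup_apply_mem w.2 β.2⟩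
  refine Finite.of_injective f fun w v h => ?_
  apply Subtype.ext
  apply LinearEquiv.toLinearMap_injective
  refine LinearMap.ext_on hΔ.span_eq_top fun β hβ => ?_
  exact congrArg Subtype.val (congrFun h ⟨β, hβ⟩)

end IsEuclideanRootSystem

/-- The subgroup generated by the reflections in the basis vectors. -/
noncomputable def simpleReflectionGroup
    (α : Module.Basis (Fin n) ℝ (EuclideanSpace ℝ (Fin n))) :
    Subgroup (EuclideanSpace ℝ (Fin n) ≃ₗ[ℝ] EuclideanSpace ℝ (Fin n)) :=
  Subgroup.closure (Set.range fun i => rootReflection (α i))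

/-- The product of a word in the simple reflections. -/
noncomputable def simpleWord (α : Module.Basis (Fin n) ℝ (EuclideanSpace ℝ (Fin n)))
    (l : List (Fin n)) : EuclideanSpace ℝ (Fin n) ≃ₗ[ℝ] EuclideanSpace ℝ (Fin n) :=
  (l.map fun i => rootReflection (α i)).prod

theorem exists_simpleWord {w : EuclideanSpace ℝ (Fin n) ≃ₗ[ℝ] EuclideanSpace ℝ (Fin n)}
    (hw : w ∈ simpleReflectionGroup α) : ∃ l, simpleWord α l = w := by
  induction hw using Subgroup.closure_induction'' with
  | mem r hr =>
    obtain ⟨i, rfl⟩ := hr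
    exact ⟨[i], by simp [simpleWord]⟩
  | inv_mem r hr =>
    obtain ⟨i, rfl⟩ := hr
    refine ⟨[i], ?_⟩
    simpa [simpleWord] using (inv_eq_of_mul_eq_one_left (rootReflection_mul_self (α i))).symm
  | one => exact ⟨[], rfl⟩
  | mul g h _ _ ihg ihh =>
    obtain ⟨l, rfl⟩ := ihg
    obtain ⟨l', rfl⟩ := ihh
    exact ⟨l ++ l', by simp [simpleWord]⟩

namespace IsSimpleSystem

theorem simpleReflectionGroup_le (hα : IsSimpleSystem Δ α) :
    simpleReflectionGroup α ≤ reflectionGroup Δ := by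
  refine (Subgroup.closure_le _).2 ?_
  rintro _ ⟨i, rfl⟩
  exact rootReflection_mem_reflectionGroup (hα.mem i)

theorem repr_rootReflection_of_ne (β : EuclideanSpace ℝ (Fin n)) {i j : Fin n} (h : j ≠ i) :
    α.repr (rootReflection (α i) β) j = α.repr β j := by
  rw [rootReflection_apply]
  simp [h.symm]

theorem not_nonneg_and_nonpos (hΔ : IsEuclideanRootSystem Δ)
    {β : EuclideanSpace ℝ (Fin n)} (hβ : β ∈ Δ) (h1 : ∀ i, 0 ≤ α.repr β i) (h2 : ∀ i, α.repr β i ≤ 0) : False := by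
  refine hΔ.ne_zero β hβ (α.repr.map_eq_zero_iff.1 (Finsupp.ext fun i => ?_))
  exact le_antisymm (h2 i) (h1 i)

variable (hΔ : IsEuclideanRootSystem Δ) (hα : IsSimpleSystem Δ α)
include hΔ hα

/-- A simple reflection permutes the positive roots other than its own simple root. -/
theorem rootReflection_nonneg {β : EuclideanSpace ℝ (Fin n)} (hβ : β ∈ Δ)
    (h : ∀ j, 0 ≤ α.repr β j) {i : Fin n} (hi : β ≠ α i) (j : Fin n) :
    0 ≤ α.repr (rootReflection (α i) β) j := by
  rcases hα.same_sign _ (hΔ.rootReflection_mem (hα.mem i) hβ) with h' | h'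
  · exact h' j
  · exfalso
    -- The reflection changes only the `i`-th coordinate, so a change of sign forces all others to
    -- vanish. Then `β` is a root on the line of `α i`.
    have h0 : ∀ j, j ≠ i → α.repr β j = 0 := fun j hj =>
      le_antisymm ((repr_rootReflection_of_ne β hj).symm.trans_le (h' j)) (h j)
    have hs : β = α.repr β i • α i := by
      conv_lhs => rw [← α.sum_repr β]
      exact Finset.sum_eq_single i (fun j _ hj => by rw [h0 j hj, zero_smul]) (by simp)
    have hm : β ∈ Δ ∩ (Submodule.span ℝ {α i} : Set (EuclideanSpace ℝ (Fin n))) :=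
      ⟨hβ, Submodule.mem_span_singleton.2 ⟨_, hs.symm⟩⟩
    rw [hΔ.inter_line _ (hα.mem i)] at hm
    rcases hm with hm | hm
    · exact hi hm
    · have := h i
      rw [Set.mem_singleton_iff.1 hm] at this
      simp at this
      linarith

/-- Applying the word letter by letter from the right, some letter `j` first turns the image of `α
i` negative. Only `α j` itself can change sign there, so `α j = v (α i)` with `v` the product of the
later letters. Hence `r_j = v r_i v⁻¹`, and `r_j v r_i = v`: the letter `j` is deleted. -/
theorem exchange (l : List (Fin n)) (i : Fin n)
    (h : ∀ j, α.repr (simpleWord α l (α i)) j ≤ 0) :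
    ∃ l' : List (Fin n), l'.length + 1 = l.length ∧
      simpleWord α l * rootReflection (α i) = simpleWord α l' := by
  induction l with
  | nil =>
    have := h i
    simp [simpleWord] at this
    linarith
  | cons j l ih =>
    have hcons : ∀ l, simpleWord α (j :: l) = rootReflection (α j) * simpleWord α l := fun l => by
      simp [simpleWord]
    have hw : simpleWord α l ∈ reflectionGroup Δ := by
      refine Subgroup.list_prod_mem _ fun r hr => ?_
      obtain ⟨k, -, rfl⟩ := List.mem_map.1 hr
      exact rootReflection_mem_reflectionGroup (hα.mem k)
    have hroot := hΔ.reflectionGroup_apply_mem hw (hα.mem i)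
    rcases hα.same_sign _ hroot with hp | hn
    · have heq : simpleWord α l (α i) = α j := by
        by_contra hne
        have h1 := hα.rootReflection_nonneg hΔ hroot hp hne
        rw [hcons] at h
        exact not_nonneg_and_nonpos hΔ (hΔ.rootReflection_mem (hα.mem j) hroot) h1 h
      refine ⟨l, rfl, ?_⟩
      rw [hcons, ← heq, conj_rootReflection _ (inner_reflectionGroup hw)]
      calc _ = simpleWord α l * (rootReflection (α i) * rootReflection (α i)) := by group
        _ = _ := by rw [rootReflection_mul_self, mul_one]
    · obtain ⟨l', hl, he⟩ := ih hn
      exact ⟨j :: l', by simp [hl], by rw [hcons, hcons, mul_assoc, he]⟩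

/-- If the word is `v r_i`, positivity of the image of `α i` makes `v (α i)` negative, and
`exchange` rewrites the word with two letters fewer. -/
theorem simpleWord_eq_one (l : List (Fin n))
    (h : ∀ i j, 0 ≤ α.repr (simpleWord α l (α i)) j) : simpleWord α l = 1 := by
  induction hk : l.length using Nat.strong_induction_on generalizing l with
  | _ k ih =>
    rcases List.eq_nil_or_concat l with rfl | ⟨l₁, i, rfl⟩
    · rfl
    · have happ : simpleWord α (l₁.concat i) = simpleWord α l₁ * rootReflection (α i) := by
        simp [simpleWord]
      have hneg : ∀ j, α.repr (simpleWord α l₁ (α i)) j ≤ 0 := fun j => by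
        have := h i j
        rw [happ, LinearEquiv.mul_apply, rootReflection_self, map_neg, map_neg] at this
        simpa using this
      obtain ⟨l', hl, he⟩ := hα.exchange hΔ l₁ i hneg
      rw [happ, he] at h ⊢
      exact ih l'.length (by simp at hk; omega) l' h rfl

/-- Every positive root is conjugate to a simple root under the simple reflections. -/
theorem exists_simple_conj {β : EuclideanSpace ℝ (Fin n)} (hβ : β ∈ Δ)
    (hpos : ∀ j, 0 ≤ α.repr β j) :
    ∃ w ∈ simpleReflectionGroup α, ∃ i, w β = α i := by
  let T : Set (EuclideanSpace ℝ (Fin n)) :=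
    {γ | γ ∈ Δ ∧ (∀ j, 0 ≤ α.repr γ j) ∧ ∃ w ∈ simpleReflectionGroup α, w β = γ}
  -- Take a positive root of least height (coefficient sum) in the orbit. Since `(γ, γ) > 0`, some
  -- simple root pairs positively with it, and that reflection would lower the height unless `γ` is
  -- that simple root.
  obtain ⟨γ, ⟨hγ, hγp, w, hw, rfl⟩, hmin⟩ :=
    Set.exists_min_image T (fun γ => ∑ j, α.repr γ j) (hΔ.finite.subset fun γ h => h.1)
      ⟨β, hβ, hpos, 1, one_mem _, rfl⟩
  set γ := w β with hγdef
  obtain ⟨i, hi0, hi⟩ : ∃ i, 0 < α.repr γ i ∧ 0 < ⟪γ, α i⟫_ℝ := by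
    by_contra! hcon
    have : ⟪γ, γ⟫_ℝ ≤ 0 := by
      nth_rewrite 2 [← α.sum_repr γ]
      rw [inner_sum]
      refine Finset.sum_nonpos fun i _ => ?_
      rw [inner_smul_right]
      rcases (hγp i).eq_or_lt with h | h
      · simp [← h]
      · exact mul_nonpos_of_nonneg_of_nonpos h.le (hcon i h)
    exact absurd this (not_le.2 (real_inner_self_pos.2 (hΔ.ne_zero γ hγ)))
  refine ⟨w, hw, i, ?_⟩
  by_contra hne
  have h1 := hα.rootReflection_nonneg hΔ hγ hγp hne
  have h2 := hmin (rootReflection (α i) γ) ⟨hΔ.rootReflection_mem (hα.mem i) hγ, h1,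
    rootReflection (α i) * w, mul_mem (Subgroup.subset_closure ⟨i, rfl⟩) hw, rfl⟩
  simp only [rootReflection_apply, map_sub, map_smul, Finsupp.sub_apply, Finsupp.smul_apply,
    Finset.sum_sub_distrib, Module.Basis.repr_self, smul_eq_mul, ← Finset.mul_sum] at h2
  have h3 : ∑ j, (Finsupp.single i (1 : ℝ)) j = 1 := by simp [Finsupp.single_apply]
  rw [h3] at h2
  have h4 : 0 < 2 * ⟪γ, α i⟫_ℝ / ⟪α i, α i⟫_ℝ :=
    div_pos (by linarith) (real_inner_self_pos.2 (α.ne_zero i))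
  linarith

/-- Each positive root is conjugate to a simple one, so its reflection is a conjugate of a simple
reflection; `-β` and `β` have the same reflection. This makes every element of `W` a word to which
`exchange` applies. -/
theorem simpleReflectionGroup_eq : simpleReflectionGroup α = reflectionGroup Δ := by
  refine le_antisymm (hα.simpleReflectionGroup_le) ((Subgroup.closure_le _).2 ?_)
  have key : ∀ β ∈ Δ, (∀ j, 0 ≤ α.repr β j) → rootReflection β ∈ simpleReflectionGroup α := by
    intro β hβ hp
    obtain ⟨w, hw, i, hi⟩ := hα.exists_simple_conj hΔ hβ hp
    have h1 := conj_rootReflection w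
      (inner_reflectionGroup (hα.simpleReflectionGroup_le hw)) β
    have h2 : rootReflection β = w⁻¹ * rootReflection (α i) * w := by
      rw [← hi, h1]; group
    rw [h2]
    exact mul_mem (mul_mem (inv_mem hw) (Subgroup.subset_closure ⟨i, rfl⟩)) hw
  rintro _ ⟨β, hβ, rfl⟩
  change rootReflection β ∈ simpleReflectionGroup α
  rcases hα.same_sign β hβ with h | h
  · exact key β hβ h
  · have := key (-β) (hΔ.neg_mem hβ) (by simpa using h)
    have hneg : rootReflection (-β) = rootReflection β := by
      ext1 x; simp [rootReflection_apply, neg_div]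
    rwa [hneg] at this

/-- The reflection group acts freely on the open fundamental chamber. -/
theorem eq_one_of_mem_chamber
    {w : EuclideanSpace ℝ (Fin n) ≃ₗ[ℝ] EuclideanSpace ℝ (Fin n)} (hw : w ∈ reflectionGroup Δ)
    {x : EuclideanSpace ℝ (Fin n)} (hx : ∀ i, 0 < ⟪x, α i⟫_ℝ) (hwx : ∀ i, 0 < ⟪w x, α i⟫_ℝ) :
    w = 1 := by
  obtain ⟨l, rfl⟩ := exists_simpleWord (hα.simpleReflectionGroup_eq hΔ ▸ hw)
  refine hα.simpleWord_eq_one hΔ l fun i => ?_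
  set w := simpleWord α l
  rcases hα.same_sign _ (hΔ.reflectionGroup_apply_mem hw (hα.mem i)) with h | h
  · exact h
  · exfalso
    -- If `w (α i)` were negative, expanding it in simple roots would make this inner product
    -- nonpositive.
    have h1 : 0 < ⟪w x, w (α i)⟫_ℝ := (inner_reflectionGroup hw x (α i)).symm ▸ hx i
    rw [← α.sum_repr (w (α i)), inner_sum] at h1
    refine absurd h1 (not_lt.2 (Finset.sum_nonpos fun j _ => ?_))
    rw [inner_smul_right]
    exact mul_nonpos_of_nonpos_of_nonneg (h j) (hwx j).le

/-- Every point can be moved into the fundamental cone. -/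
theorem exists_mem_fundamentalCone {ρ : EuclideanSpace ℝ (Fin n)} (hρ : ∀ i, 0 < ⟪ρ, α i⟫_ℝ)
    (x : EuclideanSpace ℝ (Fin n)) : ∃ w ∈ reflectionGroup Δ, w x ∈ fundamentalCone α := by
  have := hΔ.finite_reflectionGroup
  -- Reflecting the maximiser in `α i` subtracts a multiple of `(α i, ρ) > 0` having the sign of `(w
  -- x, α i)`, which is therefore nonnegative.
  obtain ⟨w, hw⟩ := Finite.exists_max fun w : reflectionGroup Δ => ⟪w.1 x, ρ⟫_ℝ
  refine ⟨w.1, w.2, fun i => ?_⟩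
  have h1 := hw ⟨rootReflection (α i) * w.1,
    mul_mem (rootReflection_mem_reflectionGroup (hα.mem i)) w.2⟩
  simp only [LinearEquiv.mul_apply, rootReflection_apply, inner_sub_left, inner_smul_left] at h1
  have h2 : 0 ≤ 2 * ⟪w.1 x, α i⟫_ℝ / ⟪α i, α i⟫_ℝ * ⟪α i, ρ⟫_ℝ := by
    simpa using h1
  have h3 : 0 < ⟪α i, ρ⟫_ℝ := real_inner_comm ρ (α i) ▸ hρ i
  have h4 : 0 < ⟪α i, α i⟫_ℝ := real_inner_self_pos.2 (α.ne_zero i)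
  have h5 := nonneg_of_mul_nonneg_left h2 h3
  rw [le_div_iff₀ h4] at h5
  linarith

end IsSimpleSystem
end RootSystems

/-! ### Measurable Schröder–Bernstein -/

/-- A measurable Schröder–Bernstein theorem: if `φ` is injective on `F` and `ψ` maps a subset of `F`
bijectively onto the whole space, then `F` splits into two measurable parts whose images under `φ`
and `ψ` respectively partition the space. -/
theorem exists_measurable_schroederBernstein {X Y : Type*} [MeasurableSpace X]
    [StandardBorelSpace X] [MeasurableSpace Y] [MeasurableSpace.CountablySeparated Y]
    {φ ψ : X → Y} (hφ : Measurable φ) (hψ : Measurable ψ) {F S : Set X} (hF : MeasurableSet F)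
    (hS : MeasurableSet S) (hSF : S ⊆ F) (hφF : Set.InjOn φ F) (hψS : Set.BijOn ψ S Set.univ) :
    ∃ F₂ ⊆ F, MeasurableSet F₂ ∧ Set.InjOn ψ F₂ ∧ Disjoint (φ '' (F \ F₂)) (ψ '' F₂) ∧
      φ '' (F \ F₂) ∪ ψ '' F₂ = Set.univ := by
  -- `U k` collects the points reached from `F \ S` after `k` steps of `ψ⁻¹ ∘ φ` into `S`. Their
  -- union is treated by `φ`; its complement in `F` lies in `S` and is treated by `ψ`. Injective
  -- images of measurable sets are measurable, so all `U k` are.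
  let T : Set X → Set X := fun U => S ∩ ψ ⁻¹' (φ '' U)
  let U : ℕ → Set X := fun k => T^[k] (F \ S)
  have hU0 : U 0 = F \ S := rfl
  have hUs : ∀ k, U (k + 1) = S ∩ ψ ⁻¹' (φ '' U k) := fun k => Function.iterate_succ_apply' _ _ _
  have hUF : ∀ k, U k ⊆ F := by
    intro k
    cases k with
    | zero => exact Set.sdiff_subset
    | succ k => rw [hUs]; exact Set.inter_subset_left.trans hSF
  have hUm : ∀ k, MeasurableSet (U k) := by
    intro k
    induction k with
    | zero => exact hF.diff hS
    | succ k ih =>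
      rw [hUs]
      exact hS.inter (hψ (ih.image_of_measurable_injOn hφ (hφF.mono (hUF k))))
  let F₁ := ⋃ k, U k
  have hF₁F : F₁ ⊆ F := Set.iUnion_subset hUF
  have hsub : F \ F₁ ⊆ S := fun x hx => by
    by_contra h
    exact hx.2 (Set.mem_iUnion.2 ⟨0, hx.1, h⟩)
  refine ⟨F \ F₁, Set.sdiff_subset, hF.diff (MeasurableSet.iUnion hUm), hψS.injOn.mono hsub, ?_, ?_⟩
  · rw [Set.sdiff_sdiff_cancel_left hF₁F, Set.disjoint_left]
    rintro _ ⟨x, hx, rfl⟩ ⟨y, hy, hxy⟩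
    obtain ⟨k, hk⟩ := Set.mem_iUnion.1 hx
    refine hy.2 (Set.mem_iUnion.2 ⟨k + 1, ?_⟩)
    rw [hUs]
    exact ⟨hsub hy, x, hk, hxy.symm⟩
  · rw [Set.sdiff_sdiff_cancel_left hF₁F, Set.eq_univ_iff_forall]
    intro y
    obtain ⟨s, hs, rfl⟩ := hψS.surjOn (Set.mem_univ y)
    by_cases h : s ∈ F₁
    · left
      obtain ⟨k, hk⟩ := Set.mem_iUnion.1 h
      cases k with
      | zero => exact absurd hs hk.2
      | succ k =>
        rw [hUs] at hk
        exact Set.image_mono (Set.subset_iUnion U k) hk.2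
    · exact Or.inr ⟨s, ⟨hSF hs, h⟩, rfl⟩

/-! ### Tiling the orthant and representing the torus -/

section Coordinates

variable {n : ℕ}

/-- The projection of a space with linear coordinates `L` onto the torus `(ℝ/ℤ)ⁿ`. -/
def torusProj {E : Type*} [AddCommGroup E] [Module ℝ E] (L : E ≃ₗ[ℝ] (Fin n → ℝ)) (x : E) :
    UnitAddTorus (Fin n) :=
  fun i => (L x i : UnitAddCircle)

variable {E : Type*} [NormedAddCommGroup E] [NormedSpace ℝ E]

theorem measurable_torusProj [FiniteDimensional ℝ E] [MeasurableSpace E] [BorelSpace E]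
    (L : E ≃ₗ[ℝ] (Fin n → ℝ)) : Measurable (torusProj L) := by
  refine measurable_pi_lambda _ fun i => AddCircle.measurable_mk'.comp ?_
  exact (measurable_pi_apply i).comp
    (L : E →ₗ[ℝ] (Fin n → ℝ)).continuous_of_finiteDimensional.measurable

theorem unitAddCircle_coe_eq_iff {x y : ℝ} :
    (x : UnitAddCircle) = y ↔ ∃ k : ℤ, x - y = k := by
  rw [← sub_eq_zero, ← AddCircle.coe_sub, AddCircle.coe_eq_zero_iff]
  simp [eq_comm]

theorem bijOn_torusProj_Ioc (L : E ≃ₗ[ℝ] (Fin n → ℝ)) (γ : Fin n → ℝ) :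
    Set.BijOn (torusProj L) {x | ∀ i, L x i ∈ Set.Ioc (γ i) (γ i + 1)} Set.univ := by
  refine ⟨fun _ _ => Set.mem_univ _, fun x hx y hy h => ?_, fun t _ => ?_⟩
  · refine L.injective (funext fun i => ?_)
    exact (AddCircle.coe_eq_coe_iff_of_mem_Ioc (p := (1 : ℝ)) (hx i) (hy i)).1 (congrFun h i)
  · refine ⟨L.symm fun i => (AddCircle.equivIoc 1 (γ i) (t i)).1, fun i => ?_, ?_⟩
    · rw [L.apply_symm_apply]
      exact (AddCircle.equivIoc 1 (γ i) (t i)).2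
    · funext i
      simp only [torusProj, L.apply_symm_apply]
      exact AddCircle.coe_equivIoc

theorem exists_norm_le_mul_norm (f g : E ≃ₗ[ℝ] (Fin n → ℝ)) :
    ∃ M : ℝ, 0 < M ∧ ∀ x, ‖g x‖ ≤ M * ‖f x‖ := by
  let T : (Fin n → ℝ) →L[ℝ] (Fin n → ℝ) :=
    LinearMap.toContinuousLinearMap (f.symm.trans g : (Fin n → ℝ) →ₗ[ℝ] (Fin n → ℝ))
  refine ⟨‖T‖ + 1, by positivity, fun x => ?_⟩
  have h : ‖g x‖ ≤ ‖T‖ * ‖f x‖ := by simpa [T] using T.le_opNorm (f x)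
  nlinarith [norm_nonneg (f x)]

theorem exists_forall_lt_pow {a : Fin n → ℝ} (ha : ∀ j, 1 < a j) (R : Fin n → ℝ) :
    ∃ m : ℕ, ∀ j, R j < a j ^ m :=
  (Filter.eventually_all.2 fun j =>
    (tendsto_pow_atTop_atTop_of_one_lt (ha j)).eventually_gt_atTop (R j)).exists

variable {c : E ≃ₗ[ℝ] (Fin n → ℝ)} {A : E ≃ₗ[ℝ] E} {a : Fin n → ℝ}

theorem coord_zpow_apply (ha : ∀ j, 1 < a j) (hA : ∀ x j, c (A x) j = a j * c x j) (k : ℤ) (x : E)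
    (j : Fin n) : c ((A ^ k) x) j = a j ^ k * c x j := by
  have ha0 : a j ≠ 0 := (zero_lt_one.trans (ha j)).ne'
  induction k with
  | zero => simp
  | succ k ih =>
    rw [add_comm, zpow_add, zpow_one, LinearEquiv.mul_apply, hA, ih, zpow_add₀ ha0, zpow_one,
      mul_assoc]
  | pred k ih =>
    have h : a j * c ((A ^ (-(k : ℤ) - 1)) x) j = c ((A ^ (-(k : ℤ))) x) j := by
      rw [← hA, ← LinearEquiv.mul_apply, ← zpow_one_add,
        show 1 + (-(k : ℤ) - 1) = -k by ring]
    rw [ih] at h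
    rw [zpow_sub_one₀ ha0, eq_comm, ← mul_right_inj' ha0, h]
    field_simp

/-- The part of the positive orthant between the unit cube and its dilate by `a`. -/
def dilationShell (c : E ≃ₗ[ℝ] (Fin n → ℝ)) (a : Fin n → ℝ) : Set E :=
  {x | (∀ j, 0 ≤ c x j ∧ c x j < a j) ∧ ∃ j, 1 ≤ c x j}

/-- The exponents `k` for which all coordinates of `A^k x` are below `1` form a nonempty down-set of
`ℤ`, bounded above. The orbit is in the shell exactly at the successor of its maximum. -/
theorem existsUnique_zpow_mem_dilationShell (ha : ∀ j, 1 < a j)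
    (hA : ∀ x j, c (A x) j = a j * c x j) {x : E} (hx : ∀ j, 0 ≤ c x j) (hx0 : x ≠ 0) :
    ∃! k : ℤ, (A ^ k) x ∈ dilationShell c a := by
  have hap : ∀ j, 0 < a j := fun j => zero_lt_one.trans (ha j)
  let P : ℤ → Prop := fun k => ∀ j, a j ^ k * c x j < 1
  have hmem : ∀ k, (A ^ k) x ∈ dilationShell c a ↔ P (k - 1) ∧ ¬ P k := by
    intro k
    simp only [dilationShell, Set.mem_ofPred_eq, coord_zpow_apply ha hA, P, not_forall, not_lt]
    refine and_congr_left fun _ => forall_congr' fun j => ?_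
    rw [zpow_sub_one₀ (hap j).ne', mul_right_comm, ← div_eq_mul_inv, div_lt_one (hap j)]
    exact and_iff_right (mul_nonneg (zpow_pos (hap j) k).le (hx j))
  have hanti : ∀ k l : ℤ, k ≤ l → P l → P k := fun k l hkl h j =>
    (mul_le_mul_of_nonneg_right (zpow_le_zpow_right₀ (ha j).le hkl) (hx j)).trans_lt (h j)
  obtain ⟨j₀, hj₀⟩ : ∃ j, 0 < c x j := by
    by_contra! h
    exact hx0 (c.map_eq_zero_iff.1 (funext fun j => le_antisymm (h j) (hx j)))
  obtain ⟨m, hm⟩ := exists_forall_lt_pow ha (fun j => c x j)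
  obtain ⟨m', hm'⟩ := exists_forall_lt_pow ha (fun j => 1 / c x j)
  have hne : ∃ k, P k := by
    refine ⟨-(m : ℤ), fun j => ?_⟩
    rw [zpow_neg, zpow_natCast, inv_mul_lt_one₀ (pow_pos (hap j) m)]
    exact hm j
  have hbd : ∃ b : ℤ, ∀ k, P k → k ≤ b := by
    refine ⟨m', fun k hk => ?_⟩
    by_contra! hlt
    have h1 := hanti _ _ hlt.le hk j₀
    have h2 := hm' j₀
    rw [div_lt_iff₀ hj₀] at h2
    rw [zpow_natCast] at h1
    linarith
  obtain ⟨k₀, hk₀, hmax⟩ := Int.exists_greatest_of_bdd hbd hne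
  refine ⟨k₀ + 1, (hmem _).2 ⟨by simpa using hk₀, fun h => by have := hmax _ h; omega⟩, ?_⟩
  intro k hk
  obtain ⟨h1, h2⟩ := (hmem k).1 hk
  have h3 := hmax _ h1
  by_contra hne
  exact h2 (hanti k k₀ (by omega) hk₀)

theorem exists_injOn_torusProj_zpow (ha : ∀ j, 1 < a j) (hA : ∀ x j, c (A x) j = a j * c x j)
    (L : E ≃ₗ[ℝ] (Fin n → ℝ)) :
    ∃ k : ℤ, Set.InjOn (fun x => torusProj L ((A ^ k) x)) (dilationShell c a) := by
  obtain ⟨M, hM0, hM⟩ := exists_norm_le_mul_norm c L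
  -- Shell coordinates are below `a j`, so contraction by `A^{-m}` brings them below `1 / (2M)`, and
  -- the `L`-coordinates below `1/2`. Congruent points then coincide.
  obtain ⟨m, hm⟩ := exists_forall_lt_pow ha (fun j => 2 * M * a j)
  have hap : ∀ j, 0 < a j := fun j => zero_lt_one.trans (ha j)
  have hsmall : ∀ x ∈ dilationShell c a, ∀ i, |L ((A ^ (-(m : ℤ))) x) i| < 1 / 2 := by
    intro x hx i
    obtain ⟨j₀, -⟩ := hx.2
    have h1 : ‖c ((A ^ (-(m : ℤ))) x)‖ < 1 / (2 * M) := by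
      rw [pi_norm_lt_iff (by positivity)]
      intro j
      have hp := pow_pos (hap j) m
      rw [coord_zpow_apply ha hA, zpow_neg, zpow_natCast, Real.norm_eq_abs,
        abs_of_nonneg (mul_nonneg (inv_pos.2 hp).le (hx.1 j).1), inv_mul_lt_iff₀ hp,
        mul_one_div, lt_div_iff₀ (by positivity)]
      have := mul_lt_mul_of_pos_right (hx.1 j).2 (by positivity : 0 < 2 * M)
      linarith [hm j]
    calc |L ((A ^ (-(m : ℤ))) x) i| ≤ ‖L ((A ^ (-(m : ℤ))) x)‖ := norm_le_pi_norm (L _) i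
      _ ≤ M * ‖c ((A ^ (-(m : ℤ))) x)‖ := hM _
      _ < M * (1 / (2 * M)) := mul_lt_mul_of_pos_left h1 hM0
      _ = 1 / 2 := by field_simp
  refine ⟨-(m : ℤ), fun x hx y hy hxy =>
    (A ^ (-(m : ℤ))).injective (L.injective (funext fun i => ?_))⟩
  obtain ⟨z, hz⟩ := unitAddCircle_coe_eq_iff.1 (congrFun hxy i)
  have h1 := hsmall x hx i
  have h2 := hsmall y hy i
  rw [abs_lt] at h1 h2
  have h3 : (z : ℝ) < 1 := by linarith
  have h4 : (-1 : ℝ) < z := by linarith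
  have h5 : z < 1 := by exact_mod_cast h3
  have h6 : -1 < z := by exact_mod_cast h4
  have h7 : z = 0 := by omega
  rw [h7, Int.cast_zero, sub_eq_zero] at hz
  exact hz

theorem exists_bijOn_torusProj_zpow [FiniteDimensional ℝ E] [MeasurableSpace E] [BorelSpace E]
    [NeZero n]
    (ha : ∀ j, 1 < a j) (hA : ∀ x j, c (A x) j = a j * c x j) (L : E ≃ₗ[ℝ] (Fin n → ℝ)) :
    ∃ (k : ℤ) (S : Set E), MeasurableSet S ∧ S ⊆ dilationShell c a ∧
      Set.BijOn (fun x => torusProj L ((A ^ k) x)) S Set.univ := by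
  obtain ⟨M, hM0, hM⟩ := exists_norm_le_mul_norm L c
  -- The shell contains the box `∏ (1, a j)`, with centre `y₀` and half-widths `(a j - 1) / 2`. This
  -- `m` makes the pullback of a unit `L`-cell cornered at the image of `y₀` deviate from `y₀` by
  -- less than the half-widths.
  obtain ⟨m, hm⟩ := exists_forall_lt_pow ha (fun j => 2 * M / (a j - 1))
  let y₀ : E := c.symm fun j => (1 + a j) / 2
  let γ := L ((A ^ (m : ℤ)) y₀)
  let S : Set E := {x | ∀ i, L ((A ^ (m : ℤ)) x) i ∈ Set.Ioc (γ i) (γ i + 1)}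
  refine ⟨m, S, ?_, fun x hx => ?_, ?_⟩
  · have hS : S = (fun x => L ((A ^ (m : ℤ)) x)) ⁻¹'
        Set.univ.pi fun i => Set.Ioc (γ i) (γ i + 1) := by
      ext x; simp [S]
    rw [hS]
    refine (((A ^ (m : ℤ)).trans L : E ≃ₗ[ℝ] (Fin n → ℝ)) :
      E →ₗ[ℝ] (Fin n → ℝ)).continuous_of_finiteDimensional.measurable
      (MeasurableSet.univ_pi fun i => measurableSet_Ioc)
  · have h1 : ‖L ((A ^ (m : ℤ)) (x - y₀))‖ ≤ 1 := by
      rw [pi_norm_le_iff_of_nonneg zero_le_one]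
      intro i
      have := hx i
      rw [map_sub, map_sub, Pi.sub_apply, Real.norm_eq_abs, abs_le]
      constructor <;> linarith [this.1, this.2, (rfl : γ i = L ((A ^ (m : ℤ)) y₀) i)]
    have h2 : ∀ j, |c x j - (1 + a j) / 2| < (a j - 1) / 2 := by
      intro j
      have hp := pow_pos (zero_lt_one.trans (ha j)) m
      have h3 : ‖c ((A ^ (m : ℤ)) (x - y₀)) j‖ ≤ M :=
        (norm_le_pi_norm _ j).trans ((hM _).trans (by nlinarith))
      rw [coord_zpow_apply ha hA, map_sub, Pi.sub_apply, zpow_natCast, norm_mul,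
        Real.norm_eq_abs, abs_of_pos hp, Real.norm_eq_abs] at h3
      simp only [y₀, c.apply_symm_apply] at h3
      have h4 := hm j
      have h5 : 0 < a j - 1 := sub_pos.2 (ha j)
      rw [div_lt_iff₀ h5] at h4
      nlinarith
    refine ⟨fun j => ?_, 0, ?_⟩
    · have := abs_lt.1 (h2 j)
      constructor <;> linarith [ha j]
    · have := abs_lt.1 (h2 0)
      linarith
  · have h := bijOn_torusProj_Ioc ((A ^ (m : ℤ)).trans L) γ
    exact h

theorem measurableSet_dilationShell [FiniteDimensional ℝ E] [MeasurableSpace E] [BorelSpace E] :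
    MeasurableSet (dilationShell c a) := by
  have hc : ∀ j, Measurable fun x => c x j := fun j => (measurable_pi_apply j).comp
    (c : E →ₗ[ℝ] (Fin n → ℝ)).continuous_of_finiteDimensional.measurable
  have : dilationShell c a =
      (⋂ j, {x | 0 ≤ c x j} ∩ {x | c x j < a j}) ∩ ⋃ j, {x | 1 ≤ c x j} := by
    ext x; simp [dilationShell]
  rw [this]
  exact (MeasurableSet.iInter fun j => (measurableSet_le measurable_const (hc j)).inter
    (measurableSet_lt (hc j) measurable_const)).inter
    (MeasurableSet.iUnion fun j => measurableSet_le measurable_const (hc j))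

/-- A subset of the positive orthant that tiles it by the powers of a diagonal expansion and is a
set of representatives of the torus. -/
theorem exists_orthant_tile [FiniteDimensional ℝ E] [MeasurableSpace E] [BorelSpace E] [NeZero n]
    (ha : ∀ j, 1 < a j) (hA : ∀ x j, c (A x) j = a j * c x j) (L : E ≃ₗ[ℝ] (Fin n → ℝ)) :
    ∃ Ω : Set E, MeasurableSet Ω ∧ Ω ⊆ {x | ∀ j, 0 ≤ c x j} ∧
      (∀ x, (∀ j, 0 ≤ c x j) → x ≠ 0 → ∃! k : ℤ, (A ^ k) x ∈ Ω) ∧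
      Set.BijOn (torusProj L) Ω Set.univ := by
  obtain ⟨k₁, hk₁⟩ := exists_injOn_torusProj_zpow ha hA L
  obtain ⟨k₂, S, hSm, hS, hk₂⟩ := exists_bijOn_torusProj_zpow ha hA L
  have hAm : ∀ k : ℤ, Measurable (A ^ k : E ≃ₗ[ℝ] E) := fun k =>
    ((A ^ k : E ≃ₗ[ℝ] E) : E →ₗ[ℝ] E).continuous_of_finiteDimensional.measurable
  have hq := measurable_torusProj L
  obtain ⟨F₂, hF₂, hF₂m, hinj, hdisj, hcov⟩ := exists_measurable_schroederBernstein
    (hq.comp (hAm k₁)) (hq.comp (hAm k₂)) (measurableSet_dilationShell (c := c) (a := a)) hSm hS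
    hk₁ hk₂
  set F := dilationShell c a with hF
  have hmul : ∀ (k l : ℤ) (x : E), (A ^ k) ((A ^ l) x) = (A ^ (k + l)) x := fun k l x => by
    rw [zpow_add, LinearEquiv.mul_apply]
  -- Each orbit meets `F` once, and its point lies in exactly one piece, so the orbit also meets `Ω`
  -- once.
  let Ω : Set E := (A ^ k₁) '' (F \ F₂) ∪ (A ^ k₂) '' F₂
  have hΩ : ∀ x, x ∈ Ω ↔ ((A ^ (-k₁)) x ∈ F ∧ (A ^ (-k₁)) x ∉ F₂) ∨ (A ^ (-k₂)) x ∈ F₂ := by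
    have himg : ∀ (k : ℤ) (U : Set E) (x : E), x ∈ (A ^ k) '' U ↔ (A ^ (-k)) x ∈ U := by
      intro k U x
      constructor
      · rintro ⟨y, hy, rfl⟩
        simpa [hmul] using hy
      · exact fun h => ⟨_, h, by simp⟩
    intro x
    rw [Set.mem_union, himg, himg]
    rfl
  refine ⟨Ω, ?_, ?_, ?_, ?_⟩
  · exact (((measurableSet_dilationShell.diff hF₂m).image_of_measurable_injOn (hAm k₁)
      (LinearEquiv.injective _).injOn)).union
      (hF₂m.image_of_measurable_injOn (hAm k₂) (LinearEquiv.injective _).injOn)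
  · have hpos : ∀ (k : ℤ) (y : E), y ∈ F → ∀ j, 0 ≤ c ((A ^ k) y) j := fun k y hy j => by
      rw [coord_zpow_apply ha hA]
      exact mul_nonneg (zpow_pos (zero_lt_one.trans (ha j)) k).le (hy.1 j).1
    rintro _ (⟨y, hy, rfl⟩ | ⟨y, hy, rfl⟩)
    · exact hpos _ _ hy.1
    · exact hpos _ _ (hF₂ hy)
  · intro x hx hx0
    obtain ⟨j, hj, huniq⟩ := existsUnique_zpow_mem_dilationShell ha hA hx hx0
    by_cases h : (A ^ j) x ∈ F₂
    · refine ⟨k₂ + j, (hΩ _).2 (Or.inr (by rwa [hmul, neg_add_cancel_left])), fun k hk => ?_⟩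
      rcases (hΩ _).1 hk with ⟨h1, h2⟩ | h1
      · rw [hmul] at h1 h2
        rw [huniq _ h1] at h2
        exact absurd h h2
      · rw [hmul] at h1
        have := huniq _ (hF₂ h1)
        omega
    · refine ⟨k₁ + j, (hΩ _).2 (Or.inl (by
        rw [hmul, neg_add_cancel_left]; exact ⟨hj, h⟩)), fun k hk => ?_⟩
      rcases (hΩ _).1 hk with ⟨h1, h2⟩ | h1
      · rw [hmul] at h1
        have := huniq _ h1
        omega
      · rw [hmul] at h1
        rw [huniq _ (hF₂ h1)] at h1
        exact absurd h1 h
  · refine ⟨fun _ _ => Set.mem_univ _, ?_, ?_⟩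
    · rintro _ (⟨x, hx, rfl⟩ | ⟨x, hx, rfl⟩) _ (⟨y, hy, rfl⟩ | ⟨y, hy, rfl⟩) hxy
      · rw [hk₁ hx.1 hy.1 hxy]
      · exact (Set.disjoint_left.1 hdisj ⟨x, hx, rfl⟩ ⟨y, hy, hxy.symm⟩).elim
      · exact (Set.disjoint_left.1 hdisj ⟨y, hy, rfl⟩ ⟨x, hx, hxy⟩).elim
      · rw [hinj hx hy hxy]
    · intro t _
      have ht : t ∈ _ ∪ _ := hcov.symm ▸ Set.mem_univ t
      rcases ht with ⟨x, hx, rfl⟩ | ⟨x, hx, rfl⟩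
      · exact ⟨_, Or.inl ⟨x, hx, rfl⟩, rfl⟩
      · exact ⟨_, Or.inr ⟨x, hx, rfl⟩, rfl⟩

end Coordinates

/-! ### Fourier series on a set of torus representatives -/

section Torus

variable {n : ℕ} {E : Type*} [NormedAddCommGroup E] [NormedSpace ℝ E]

/-- The preimage of `ℤⁿ` under linear coordinates `L`. -/
def integralPoints (L : E ≃ₗ[ℝ] (Fin n → ℝ)) : AddSubgroup E :=
  (L.symm.toAddMonoidHom.comp (AddMonoidHom.pi fun i =>
    (Int.castAddHom ℝ).comp (Pi.evalAddMonoidHom (fun _ : Fin n => ℤ) i))).range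

theorem mem_integralPoints {L : E ≃ₗ[ℝ] (Fin n → ℝ)} {x : E} :
    x ∈ integralPoints L ↔ ∃ z : Fin n → ℤ, L x = fun i => (z i : ℝ) := by
  constructor
  · rintro ⟨z, rfl⟩
    exact ⟨z, L.apply_symm_apply _⟩
  · rintro ⟨z, hz⟩
    exact ⟨z, (L.symm_apply_eq.2 hz.symm : _)⟩

instance countable_integralPoints (L : E ≃ₗ[ℝ] (Fin n → ℝ)) : Countable (integralPoints L) :=
  (Set.countable_range _).to_subtype

theorem torusProj_eq_iff {L : E ≃ₗ[ℝ] (Fin n → ℝ)} {x y : E} :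
    torusProj L x = torusProj L y ↔ x - y ∈ integralPoints L := by
  simp only [funext_iff, torusProj, unitAddCircle_coe_eq_iff, mem_integralPoints, map_sub,
    Pi.sub_apply, Classical.skolem]

variable [MeasurableSpace E]

theorem isAddFundamentalDomain_of_bijOn (μ : Measure E) {L : E ≃ₗ[ℝ] (Fin n → ℝ)} {Ω : Set E}
    (hΩm : MeasurableSet Ω) (hΩ : Set.BijOn (torusProj L) Ω Set.univ) :
    IsAddFundamentalDomain (integralPoints L) Ω μ where
  nullMeasurableSet := hΩm.nullMeasurableSet
  ae_covers := Filter.Eventually.of_forall fun x => by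
    obtain ⟨y, hy, hxy⟩ := hΩ.surjOn (Set.mem_univ (torusProj L x))
    exact ⟨⟨y - x, torusProj_eq_iff.1 hxy⟩, by simpa [AddSubgroup.vadd_def] using hy⟩
  aedisjoint := fun g h hgh => by
    refine Disjoint.aedisjoint (Set.disjoint_left.2 ?_)
    rintro _ ⟨x, hx, rfl⟩ ⟨y, hy, hxy⟩
    simp only [AddSubgroup.vadd_def, vadd_eq_add] at hxy
    have : x = y := hΩ.injOn hx hy <| torusProj_eq_iff.2 <| by
      have : x - y = h - g := by rw [sub_eq_sub_iff_add_eq_add, add_comm, ← hxy, add_comm]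
      rw [this]
      exact sub_mem h.2 g.2
    subst this
    exact hgh (Subtype.ext (add_right_cancel hxy).symm)

variable [BorelSpace E] [FiniteDimensional ℝ E]

/-- The probability Haar measure on the torus `(ℝ/ℤ)ⁿ`. -/
noncomputable abbrev torusHaar (n : ℕ) : Measure (UnitAddTorus (Fin n)) :=
  Measure.pi fun _ => AddCircle.haarAddCircle

/-- Two fundamental domains give a lattice-invariant set the same measure, so `Ω` may be replaced by
the standard cell, where integration over the torus is known. -/
theorem measurePreserving_torusProj {μ : Measure E} [μ.IsAddHaarMeasure]
    {L : E ≃ₗ[ℝ] (Fin n → ℝ)} (hL : MeasurePreserving L μ volume) {Ω : Set E}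
    (hΩm : MeasurableSet Ω) (hΩ : Set.BijOn (torusProj L) Ω Set.univ) :
    MeasurePreserving (torusProj L) (μ.restrict Ω) (torusHaar n) := by
  have hq := measurable_torusProj L
  refine ⟨hq, Measure.ext fun S hS => ?_⟩
  let box : Set (Fin n → ℝ) := {x | ∀ i, x i ∈ Set.Ioc ((0 : Fin n → ℝ) i) ((0 : Fin n → ℝ) i + 1)}
  have hbox : MeasurableSet box := MeasurableSet.univ_pi' fun i => measurableSet_Ioc
  have hproj : Measurable fun (x : Fin n → ℝ) (i : Fin n) => (x i : UnitAddCircle) :=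
    measurable_pi_lambda _ fun i => AddCircle.measurable_mk'.comp (measurable_pi_apply i)
  have h1 : torusHaar n S = volume ((fun (x : Fin n → ℝ) (i : Fin n) => (x i : UnitAddCircle)) ⁻¹' S
      ∩ box) := by
    have h : ∫⁻ t, S.indicator (fun _ => 1) t ∂(torusHaar n) =
        ∫⁻ x in box, S.indicator (fun _ => 1) fun i => (x i : UnitAddCircle) :=
      UnitAddTorus.lintegral_preimage _ _
    rw [lintegral_indicator hS, setLIntegral_one] at h
    rw [h, ← Measure.restrict_apply (hproj hS), ← lintegral_indicator_one (hproj hS)]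
    rfl
  have h2 := (isAddFundamentalDomain_of_bijOn μ hΩm hΩ).measure_set_eq
    (isAddFundamentalDomain_of_bijOn μ (hL.measurable hbox) (bijOn_torusProj_Ioc L 0))
    (hq hS) fun g => by
      ext x
      have : torusProj L (g +ᵥ x) = torusProj L x := torusProj_eq_iff.2 (by
        simp [AddSubgroup.vadd_def])
      simp [this]
  rw [Measure.map_apply hq hS, Measure.restrict_apply (hq hS), h2, h1,
    ← hL.measure_preimage ((hproj hS).inter hbox).nullMeasurableSet]
  rfl

open ComplexConjugate

theorem integral_conj_mFourier_mul_mFourier (k l : Fin n → ℤ) :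
    ∫ t, conj (UnitAddTorus.mFourier k t) * UnitAddTorus.mFourier l t ∂(torusHaar n) =
      if k = l then 1 else 0 := by
  have h := orthonormal_iff_ite.1 (UnitAddTorus.orthonormal_mFourier (d := Fin n)) k l
  rw [ContinuousMap.inner_toLp] at h
  rw [← h]
  exact integral_congr_ae (Filter.Eventually.of_forall fun t => mul_comm _ _)

theorem ae_eq_zero_of_integral_mFourier_eq_zero {h : UnitAddTorus (Fin n) → ℂ}
    (hh : MemLp h 2 (torusHaar n))
    (h0 : ∀ k, ∫ t, conj (UnitAddTorus.mFourier k t) * h t ∂(torusHaar n) = 0) :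
    h =ᵐ[torusHaar n] 0 := by
  have hz : hh.toLp h = 0 := by
    refine (UnitAddTorus.mFourierBasis (d := Fin n)).repr.map_eq_zero_iff.1 ?_
    ext k
    refine (UnitAddTorus.mFourierBasis_repr _ k).trans ((integral_congr_ae ?_).trans (h0 k))
    filter_upwards [hh.coeFn_toLp] with t ht
    rw [UnitAddTorus.mFourier_neg, ht, smul_eq_mul]
  exact hh.coeFn_toLp.symm.trans ((Lp.ext_iff.1 hz).trans (Lp.coeFn_zero ℂ 2 (torusHaar n)))

variable {μ : Measure E} [μ.IsAddHaarMeasure] {L : E ≃ₗ[ℝ] (Fin n → ℝ)}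
  (hL : MeasurePreserving L μ volume) {Ω : Set E} (hΩm : MeasurableSet Ω)
  (hΩ : Set.BijOn (torusProj L) Ω Set.univ)
include hL hΩm hΩ

theorem setIntegral_conj_mFourier_mul_mFourier (k l : Fin n → ℤ) :
    ∫ x in Ω, conj (UnitAddTorus.mFourier k (torusProj L x)) *
      UnitAddTorus.mFourier l (torusProj L x) ∂μ = if k = l then 1 else 0 := by
  have h := measurePreserving_torusProj hL hΩm hΩ
  rw [← integral_conj_mFourier_mul_mFourier k l, ← h.map_eq,
    integral_map h.measurable.aemeasurable]
  refine Continuous.aestronglyMeasurable ?_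
  fun_prop

theorem ae_eq_zero_of_setIntegral_mFourier_eq_zero {g : E → ℂ} (hg : MemLp g 2 (μ.restrict Ω))
    (h0 : ∀ k, ∫ x in Ω, conj (UnitAddTorus.mFourier k (torusProj L x)) * g x ∂μ = 0) :
    g =ᵐ[μ.restrict Ω] 0 := by
  have hq := measurePreserving_torusProj hL hΩm hΩ
  -- The inverse of the projection on `Ω` is measurable because preimages under it are injective
  -- measurable images. It transports completeness of the characters from the torus to `Ω`.
  let r : UnitAddTorus (Fin n) → E := Function.invFunOn (torusProj L) Ω
  have hrm : Measurable r := by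
    intro S hS
    have : r ⁻¹' S = torusProj L '' (S ∩ Ω) := by
      ext t
      constructor
      · exact fun h => ⟨r t, ⟨h, hΩ.surjOn.mapsTo_invFunOn (Set.mem_univ t)⟩,
          hΩ.invOn_invFunOn.2 (Set.mem_univ t)⟩
      · rintro ⟨x, ⟨hxS, hx⟩, rfl⟩
        have : r (torusProj L x) = x := hΩ.invOn_invFunOn.1 hx
        rwa [Set.mem_preimage, this]
    rw [this]
    exact (hS.inter hΩm).image_of_measurable_injOn hq.measurable
      (hΩ.injOn.mono Set.inter_subset_right)
  have hrq : r ∘ torusProj L =ᵐ[μ.restrict Ω] id := by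
    filter_upwards [ae_restrict_mem hΩm] with x hx using hΩ.invOn_invFunOn.1 hx
  have hr : MeasurePreserving r (torusHaar n) (μ.restrict Ω) := by
    refine ⟨hrm, ?_⟩
    rw [← hq.map_eq, Measure.map_map hrm hq.measurable, Measure.map_congr hrq, Measure.map_id]
  have hz : g ∘ r =ᵐ[torusHaar n] 0 := by
    refine ae_eq_zero_of_integral_mFourier_eq_zero (hg.comp_measurePreserving hr) fun k => ?_
    have hqr : ∀ t, torusProj L (r t) = t := fun t => hΩ.invOn_invFunOn.2 (Set.mem_univ t)
    rw [← h0 k, ← hr.map_eq, integral_map hrm.aemeasurable]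
    · simp [hqr]
    · rw [hr.map_eq]
      refine AEStronglyMeasurable.mul ?_ hg.1
      exact (Complex.continuous_conj.comp
        (UnitAddTorus.mFourier k).continuous).measurable.comp hq.measurable |>.aestronglyMeasurable
  have := hq.quasiMeasurePreserving.ae_eq_comp hz
  filter_upwards [this, hrq] with x hx hx'
  simpa [Function.comp_apply, show r (torusProj L x) = x from hx'] using hx

end Torus

/-! ### Inverse `L²` Fourier transform as an integral -/

section FourierInverse

open FourierTransform SchwartzMap
open scoped ContDiff

variable {E : Type*} [NormedAddCommGroup E] [InnerProductSpace ℝ E] [FiniteDimensional ℝ E]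
  [MeasurableSpace E] [BorelSpace E]

theorem integral_fourierInv_smul_eq_of_integrable {f g : E → ℂ} (hf : Integrable f)
    (hg : Integrable g) : ∫ ξ, 𝓕⁻ f ξ • g ξ = ∫ x, f x • 𝓕⁻ g x := by
  have h := VectorFourier.integral_fourierIntegral_smul_eq_flip (L := -innerₗ E) (μ := volume)
    (ν := volume) Real.continuous_fourierChar
    (by simp only [LinearMap.neg_apply, innerₗ_apply_apply]; fun_prop) hf hg
  have h1 : ∀ u : E → ℂ, VectorFourier.fourierIntegral Real.fourierChar volume (-innerₗ E) u
      = 𝓕⁻ u := fun u => by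
    ext x
    simp [VectorFourier.fourierIntegral, Real.fourierInv_eq]
  have h2 : (-innerₗ E).flip = -innerₗ E := by
    ext x y
    simp [real_inner_comm]
  rwa [h2, h1, h1] at h

/-- The inverse `L²` Fourier transform of an integrable function is given by the integral. -/
theorem fourierTransformₗᵢ_symm_toLp_ae_eq {f : E → ℂ} (hf1 : Integrable f) (hf2 : MemLp f 2) :
    ((Lp.fourierTransformₗᵢ E ℂ).symm (hf2.toLp f) : E → ℂ) =ᵐ[volume] 𝓕⁻ f := by
  have hcont : Continuous (𝓕⁻ f) := by
    have : 𝓕⁻ f = VectorFourier.fourierIntegral Real.fourierChar volume (-innerₗ E) f := by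
      ext x
      simp [VectorFourier.fourierIntegral, Real.fourierInv_eq]
    rw [this]
    exact VectorFourier.fourierIntegral_continuous Real.continuous_fourierChar
      (by simp only [LinearMap.neg_apply, innerₗ_apply_apply]; fun_prop) hf1
  -- Both sides are tested against compactly supported smooth functions. The distributional inverse
  -- transform moves onto the test function and then back onto `f` by symmetry of the kernel.
  refine ae_eq_of_integral_contDiff_smul_eq
    ((Lp.memLp _).locallyIntegrable (by norm_num)) hcont.locallyIntegrable fun g hg hgs => ?_
  have hgs' : HasCompactSupport fun x => (g x : ℂ) := hgs.comp_left (g := fun r : ℝ => (r : ℂ)) rfl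
  let φ : 𝓢(E, ℂ) := hgs'.toSchwartzMap (Complex.ofRealCLM.contDiff.comp hg)
  have hφ : ∀ x, φ x = g x := fun x => rfl
  have h := congrArg (fun T : 𝓢'(E, ℂ) => T φ)
    (Lp.fourierInv_toTemperedDistribution_eq (hf2.toLp f))
  simp only [TemperedDistribution.fourierInv_apply, Lp.toTemperedDistribution_apply] at h
  have h3 : ∫ x, g x • ((Lp.fourierTransformₗᵢ E ℂ).symm (hf2.toLp f) : E → ℂ) x =
      ∫ x, (𝓕⁻ φ) x • (hf2.toLp f : E → ℂ) x := h.symm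
  rw [h3]
  calc ∫ x, (𝓕⁻ φ) x • (hf2.toLp f : E → ℂ) x = ∫ x, (𝓕⁻ (φ : E → ℂ)) x • f x := by
        refine integral_congr_ae ?_
        filter_upwards [hf2.coeFn_toLp] with x hx
        rw [hx, SchwartzMap.fourierInv_coe]
    _ = ∫ x, φ x • 𝓕⁻ f x := integral_fourierInv_smul_eq_of_integrable φ.integrable hf1
    _ = ∫ x, g x • 𝓕⁻ f x := rfl

end FourierInverse

/-! ### Contragredients and linear substitutions -/

section ChangeOfVariables

variable {E : Type*} [NormedAddCommGroup E] [InnerProductSpace ℝ E] [FiniteDimensional ℝ E]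

/-- The contragredient `d⁻ᵀ` of a linear automorphism `d`. -/
noncomputable def contragredient (d : E ≃ₗ[ℝ] E) : E ≃ₗ[ℝ] E :=
  LinearEquiv.ofLinearMap (LinearMap.adjoint (d.symm : E →ₗ[ℝ] E)) (LinearMap.adjoint (d : E →ₗ[ℝ] E))
    (by rw [← LinearMap.adjoint_comp]; simp) (by rw [← LinearMap.adjoint_comp]; simp)

theorem inner_contragredient_apply (d : E ≃ₗ[ℝ] E) (x y : E) :
    ⟪contragredient d x, d y⟫_ℝ = ⟪x, y⟫_ℝ := by
  have : contragredient d x = LinearMap.adjoint (d.symm : E →ₗ[ℝ] E) x := rfl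
  rw [this, LinearMap.adjoint_inner_left]
  simp

/-- In particular an isometry is its own contragredient, which is how elements of `W` enter. -/
theorem eq_contragredient {d e : E ≃ₗ[ℝ] E} (h : ∀ x y, ⟪e x, d y⟫_ℝ = ⟪x, y⟫_ℝ) :
    e = contragredient d := by
  ext1 x
  refine ext_inner_right ℝ fun z => ?_
  obtain ⟨y, rfl⟩ := d.surjective z
  rw [h, inner_contragredient_apply]

theorem det_contragredient (d : E ≃ₗ[ℝ] E) :
    LinearMap.det (contragredient d : E →ₗ[ℝ] E) = (LinearMap.det (d : E →ₗ[ℝ] E))⁻¹ := by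
  have h : (contragredient d : E →ₗ[ℝ] E) = LinearMap.adjoint (d.symm : E →ₗ[ℝ] E) := rfl
  let b := stdOrthonormalBasis ℝ E
  rw [h, ← LinearMap.det_toMatrix b.toBasis, LinearMap.toMatrix_adjoint,
    Matrix.det_conjTranspose, LinearMap.det_toMatrix]
  exact LinearEquiv.det_coe_symm d

variable [MeasurableSpace E] [BorelSpace E]

theorem map_linearEquiv_volume (e : E ≃ₗ[ℝ] E) :
    Measure.map e (volume : Measure E) =
      ENNReal.ofReal |(LinearMap.det (e : E →ₗ[ℝ] E))⁻¹| • volume :=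
  Measure.map_linearMap_addHaar_eq_smul_addHaar volume (LinearEquiv.isUnit_det' e).ne_zero

theorem integral_comp_linearEquiv (e : E ≃ₗ[ℝ] E) (f : E → ℂ) :
    ∫ x, f (e x) = |(LinearMap.det (e : E →ₗ[ℝ] E))⁻¹| • ∫ x, f x := by
  have h : MeasurableEmbedding e := e.toContinuousLinearEquiv.toHomeomorph.measurableEmbedding
  rw [← h.integral_map, map_linearEquiv_volume, integral_smul_measure,
    ENNReal.toReal_ofReal (abs_nonneg _)]

theorem quasiMeasurePreserving_linearEquiv (e : E ≃ₗ[ℝ] E) :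
    Measure.QuasiMeasurePreserving e (volume : Measure E) volume := by
  refine ⟨e.toContinuousLinearEquiv.continuous.measurable, ?_⟩
  rw [map_linearEquiv_volume]
  exact Measure.smul_absolutelyContinuous

theorem MeasureTheory.MemLp.comp_linearEquiv {f : E → ℂ} {p : ENNReal} (hf : MemLp f p)
    (e : E ≃ₗ[ℝ] E) : MemLp (fun x => f (e x)) p := by
  have h : MemLp f p (Measure.map e (volume : Measure E)) := by
    rw [map_linearEquiv_volume]
    exact hf.smul_measure ENNReal.ofReal_ne_top
  exact (memLp_map_measure_iff h.1 e.toContinuousLinearEquiv.continuous.measurable.aemeasurable).1 h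

open FourierTransform

/-- Substitute `η = d⁻ᵀξ`: the phase `(ξ, x)` becomes `(η, d x)` and the Jacobian is `|det d|`. -/
theorem fourierInv_modulate_comp_contragredient (d : E ≃ₗ[ℝ] E) (t : E) (f : E → ℂ) (x : E) :
    𝓕⁻ (fun ξ => Real.fourierChar ⟪contragredient d ξ, t⟫_ℝ • f (contragredient d ξ)) x =
      |LinearMap.det (d : E →ₗ[ℝ] E)| • 𝓕⁻ f (d x + t) := by
  rw [Real.fourierInv_eq, Real.fourierInv_eq]
  have h := integral_comp_linearEquiv (contragredient d)
    fun η => Real.fourierChar ⟪η, d x + t⟫_ℝ • f η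
  rw [det_contragredient, inv_inv] at h
  rw [← h]
  refine integral_congr_ae (Filter.Eventually.of_forall fun ξ => ?_)
  simp only [inner_add_right, inner_contragredient_apply, AddChar.map_add_eq_mul, mul_smul]

end ChangeOfVariables

/-! ### From tilings to wavelet sets -/

section Wavelet

open FourierTransform ComplexConjugate

variable {n : ℕ}

/-- Take `L = Gᵀ`: since `(x, G z) = (Gᵀ x, z)`, characters with frequency in `Γ` become Fourier
monomials, and determinant one preserves volume. -/
theorem exists_lattice_coordinates {G : Matrix (Fin n) (Fin n) ℝ} (hG : G.det = 1) :
    ∃ L : EuclideanSpace ℝ (Fin n) ≃ₗ[ℝ] (Fin n → ℝ), MeasurePreserving L volume volume ∧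
      ∀ (x : EuclideanSpace ℝ (Fin n)) (z : Fin n → ℤ),
        (Real.fourierChar ⟪x, WithLp.toLp 2 (G.mulVec fun i => (z i : ℝ))⟫_ℝ : ℂ) =
          UnitAddTorus.mFourier z (torusProj L x) := by
  have hdet : G.transpose.det = 1 := by rw [Matrix.det_transpose, hG]
  have hinv : IsUnit G.transpose.det := hdet ▸ isUnit_one
  let L : EuclideanSpace ℝ (Fin n) ≃ₗ[ℝ] (Fin n → ℝ) := (WithLp.linearEquiv 2 ℝ (Fin n → ℝ)).trans
    (LinearEquiv.ofIsUnitDet (f := Matrix.toLin' G.transpose)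
      (v := Pi.basisFun ℝ (Fin n)) (v' := Pi.basisFun ℝ (Fin n))
      (by rwa [LinearMap.toMatrix_eq_toMatrix', LinearMap.toMatrix'_toLin']))
  have hLa : ∀ x, L x = G.transpose.mulVec (WithLp.ofLp x) := fun x => rfl
  refine ⟨L, ?_, fun x z => ?_⟩
  · have h1 : MeasurePreserving (Matrix.toLin' G.transpose) (volume : Measure (Fin n → ℝ))
        volume := by
      refine ⟨(Matrix.toLin' G.transpose).continuous_of_finiteDimensional.measurable, ?_⟩
      rw [Real.map_matrix_volume_pi_eq_smul_volume_pi (hdet ▸ one_ne_zero), hdet]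
      simp
    exact h1.comp (PiLp.volume_preserving_ofLp (Fin n))
  · have h2 : ⟪x, WithLp.toLp 2 (G.mulVec fun i => (z i : ℝ))⟫_ℝ = ∑ i, L x i * z i := by
      rw [EuclideanSpace.inner_eq_star_dotProduct, hLa, Matrix.mulVec_transpose]
      simp only [star_trivial]
      rw [dotProduct_comm, Matrix.dotProduct_mulVec]
      rfl
    rw [h2, Real.fourierChar_apply]
    simp only [UnitAddTorus.mFourier, ContinuousMap.coe_mk, torusProj, fourier_coe_apply]
    rw [← Complex.exp_sum]
    push_cast
    rw [Finset.mul_sum, Finset.sum_mul]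
    congr 1
    refine Finset.sum_congr rfl fun i _ => ?_
    ring

/-- The character with frequency `t`, cut off to `Ω`. -/
noncomputable def cutCharacter (Ω : Set (EuclideanSpace ℝ (Fin n)))
    (t η : EuclideanSpace ℝ (Fin n)) : ℂ :=
  Real.fourierChar ⟪η, t⟫_ℝ • Ω.indicator (fun _ => (1 : ℂ)) η

theorem memLp_cutCharacter {Ω : Set (EuclideanSpace ℝ (Fin n))} (hΩ : MeasurableSet Ω)
    (hfin : volume Ω ≠ ⊤) (t : EuclideanSpace ℝ (Fin n)) (p : ENNReal) :
    MemLp (cutCharacter Ω t) p := by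
  refine (memLp_indicator_const p hΩ (1 : ℂ) (Or.inr hfin)).congr_norm ?_
    (Filter.Eventually.of_forall fun η => ?_)
  · refine Measurable.aestronglyMeasurable ?_
    have h1 : Measurable fun η : EuclideanSpace ℝ (Fin n) => (Real.fourierChar ⟪η, t⟫_ℝ : ℂ) :=
      (continuous_subtype_val.comp (Real.continuous_fourierChar.comp (by fun_prop))).measurable
    exact h1.smul ((measurable_const (a := (1 : ℂ))).indicator hΩ)
  · simp [cutCharacter]

theorem integral_conj_cutCharacter_mul {Ω : Set (EuclideanSpace ℝ (Fin n))} (hΩ : MeasurableSet Ω)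
    (t : EuclideanSpace ℝ (Fin n)) (h : EuclideanSpace ℝ (Fin n) → ℂ) :
    ∫ η, conj (cutCharacter Ω t η) * h η =
      ∫ η in Ω, conj (Real.fourierChar ⟪η, t⟫_ℝ : ℂ) * h η := by
  rw [← integral_indicator hΩ]
  congr 1
  ext η
  by_cases hη : η ∈ Ω <;> simp [cutCharacter, hη, Circle.smul_def]

/-- The Fourier transform of the dilate and translate indexed by `(d, t)`. -/
noncomputable def waveletSymbol (Ω : Set (EuclideanSpace ℝ (Fin n)))
    (d : EuclideanSpace ℝ (Fin n) ≃ₗ[ℝ] EuclideanSpace ℝ (Fin n))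
    (t ξ : EuclideanSpace ℝ (Fin n)) : ℂ :=
  (Real.sqrt |LinearMap.det (d : EuclideanSpace ℝ (Fin n) →ₗ[ℝ] EuclideanSpace ℝ (Fin n))|
    : ℂ)⁻¹ * cutCharacter Ω t (contragredient d ξ)

theorem memLp_waveletSymbol {Ω : Set (EuclideanSpace ℝ (Fin n))} (hΩ : MeasurableSet Ω)
    (hfin : volume Ω ≠ ⊤) (d : EuclideanSpace ℝ (Fin n) ≃ₗ[ℝ] EuclideanSpace ℝ (Fin n))
    (t : EuclideanSpace ℝ (Fin n)) (p : ENNReal) : MemLp (waveletSymbol Ω d t) p :=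
  ((memLp_cutCharacter hΩ hfin t p).comp_linearEquiv (contragredient d)).const_mul _

theorem sqrt_abs_det_ne_zero (d : EuclideanSpace ℝ (Fin n) ≃ₗ[ℝ] EuclideanSpace ℝ (Fin n)) :
    (Real.sqrt |LinearMap.det (d : EuclideanSpace ℝ (Fin n) →ₗ[ℝ] EuclideanSpace ℝ (Fin n))|
      : ℂ) ≠ 0 := by
  rw [Complex.ofReal_ne_zero, Real.sqrt_ne_zero']
  exact abs_pos.2 (LinearEquiv.isUnit_det' d).ne_zero

theorem sqrt_abs_det_mul_self (d : EuclideanSpace ℝ (Fin n) ≃ₗ[ℝ] EuclideanSpace ℝ (Fin n)) :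
    (Real.sqrt |LinearMap.det (d : EuclideanSpace ℝ (Fin n) →ₗ[ℝ] EuclideanSpace ℝ (Fin n))|
      : ℂ) * Real.sqrt |LinearMap.det (d : EuclideanSpace ℝ (Fin n) →ₗ[ℝ] _)| =
      (|LinearMap.det (d : EuclideanSpace ℝ (Fin n) →ₗ[ℝ] EuclideanSpace ℝ (Fin n))| : ℝ) := by
  rw [← Complex.ofReal_mul, Real.mul_self_sqrt (abs_nonneg _)]

theorem integral_conj_waveletSymbol_mul {Ω : Set (EuclideanSpace ℝ (Fin n))}
    (hΩ : MeasurableSet Ω) (d : EuclideanSpace ℝ (Fin n) ≃ₗ[ℝ] EuclideanSpace ℝ (Fin n))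
    (t : EuclideanSpace ℝ (Fin n)) (g : EuclideanSpace ℝ (Fin n) → ℂ) :
    ∫ ξ, conj (waveletSymbol Ω d t ξ) * g ξ =
      (Real.sqrt |LinearMap.det (d : EuclideanSpace ℝ (Fin n) →ₗ[ℝ] EuclideanSpace ℝ (Fin n))| : ℂ)
        * ∫ η in Ω, conj (Real.fourierChar ⟪η, t⟫_ℝ : ℂ) * g ((contragredient d).symm η) := by
  have h1 := integral_comp_linearEquiv (contragredient d)
    fun η => conj (cutCharacter Ω t η) * g ((contragredient d).symm η)
  rw [det_contragredient, inv_inv, integral_conj_cutCharacter_mul hΩ] at h1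
  simp only [LinearEquiv.symm_apply_apply] at h1
  simp only [waveletSymbol, map_mul, map_inv₀, Complex.conj_ofReal, mul_assoc]
  rw [integral_const_mul, h1, Complex.real_smul, ← sqrt_abs_det_mul_self, mul_assoc,
    inv_mul_cancel_left₀ (sqrt_abs_det_ne_zero d)]

theorem fourierInv_waveletSymbol (Ω : Set (EuclideanSpace ℝ (Fin n)))
    (d : EuclideanSpace ℝ (Fin n) ≃ₗ[ℝ] EuclideanSpace ℝ (Fin n))
    (t x : EuclideanSpace ℝ (Fin n)) :
    𝓕⁻ (waveletSymbol Ω d t) x =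
      (Real.sqrt |LinearMap.det (d : EuclideanSpace ℝ (Fin n) →ₗ[ℝ] EuclideanSpace ℝ (Fin n))| : ℂ)
        * 𝓕⁻ (Ω.indicator fun _ => (1 : ℂ)) (d x + t) := by
  have h1 := fourierInv_modulate_comp_contragredient d t (Ω.indicator fun _ => (1 : ℂ)) x
  have h2 : 𝓕⁻ (waveletSymbol Ω d t) x =
      (Real.sqrt |LinearMap.det (d : EuclideanSpace ℝ (Fin n) →ₗ[ℝ] _)| : ℂ)⁻¹ *
        𝓕⁻ (fun ξ => cutCharacter Ω t (contragredient d ξ)) x := by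
    rw [Real.fourierInv_eq, Real.fourierInv_eq, ← integral_const_mul]
    simp only [waveletSymbol, mul_smul_comm]
  rw [h2]
  simp only [cutCharacter]
  rw [h1, Complex.real_smul, ← sqrt_abs_det_mul_self, mul_assoc,
    inv_mul_cancel_left₀ (sqrt_abs_det_ne_zero d)]

variable {G : Matrix (Fin n) (Fin n) ℝ}
  {D : Set (EuclideanSpace ℝ (Fin n) ≃ₗ[ℝ] EuclideanSpace ℝ (Fin n))}
  {L : EuclideanSpace ℝ (Fin n) ≃ₗ[ℝ] (Fin n → ℝ)} {Ω : Set (EuclideanSpace ℝ (Fin n))}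

/-- A measurable set that is a set of representatives modulo the dual lattice and tiles the space
under the contragredients of a countable dilation set is a wavelet set. -/
theorem isWaveletSet_of_tiling (hD : D.Countable)
    (hL : MeasurePreserving L volume volume)
    (hchar : ∀ (x : EuclideanSpace ℝ (Fin n)) (z : Fin n → ℤ),
      (Real.fourierChar ⟪x, WithLp.toLp 2 (G.mulVec fun i => (z i : ℝ))⟫_ℝ : ℂ) =
        UnitAddTorus.mFourier z (torusProj L x))
    (hΩm : MeasurableSet Ω) (hΩ : Set.BijOn (torusProj L) Ω Set.univ)
    (htile : ∀ᵐ x : EuclideanSpace ℝ (Fin n), ∃! d, d ∈ D ∧ contragredient d x ∈ Ω) :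
    IsWaveletSet D (latticeOf G) Ω := by
  have hfin : volume Ω ≠ ⊤ := by
    have h := (measurePreserving_torusProj hL hΩm hΩ).measure_preimage
      MeasurableSet.univ.nullMeasurableSet
    rw [Set.preimage_univ, Measure.restrict_apply_univ] at h
    rw [h]
    exact measure_ne_top _ _
  have hone : MemLp (Ω.indicator fun _ => (1 : ℂ)) 2 volume :=
    memLp_indicator_const 2 hΩm (1 : ℂ) (Or.inr hfin)
  have hone1 : Integrable (Ω.indicator fun _ => (1 : ℂ)) volume :=
    memLp_one_iff_integrable.1 (memLp_indicator_const 1 hΩm (1 : ℂ) (Or.inr hfin))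
  let v : D × latticeOf G → Lp ℂ 2 (volume : Measure (EuclideanSpace ℝ (Fin n))) :=
    fun i => (memLp_waveletSymbol hΩm hfin i.1.1 i.2.1 2).toLp (waveletSymbol Ω i.1.1 i.2.1)
  have hvg : ∀ i (g : Lp ℂ 2 (volume : Measure (EuclideanSpace ℝ (Fin n)))),
      inner ℂ (v i) g = ∫ ξ, conj (waveletSymbol Ω i.1.1 i.2.1 ξ) * g ξ := by
    intro i g
    rw [L2.inner_def]
    refine integral_congr_ae ?_
    filter_upwards [(memLp_waveletSymbol hΩm hfin i.1.1 i.2.1 2).coeFn_toLp] with ξ hξ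
    rw [RCLike.inner_apply, hξ, mul_comm]
  have hortho : Orthonormal ℂ v := by
    classical
    rw [orthonormal_iff_ite]
    rintro ⟨d, t⟩ ⟨d', t'⟩
    rw [hvg]
    have h1 : ∫ ξ, conj (waveletSymbol Ω d.1 t.1 ξ) * v (d', t') ξ =
        ∫ ξ, conj (waveletSymbol Ω d.1 t.1 ξ) * waveletSymbol Ω d'.1 t'.1 ξ := by
      refine integral_congr_ae ?_
      filter_upwards [(memLp_waveletSymbol hΩm hfin d'.1 t'.1 2).coeFn_toLp] with ξ hξ
      rw [hξ]
    rw [h1]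
    by_cases hd : d = d'
    · subst hd
      -- One integer preimage is fixed per lattice point, so distinct lattice points get distinct
      -- frequencies without appeal to injectivity of `G`.
      set z := t.2.choose with hzdef
      have hz := t.2.choose_spec
      set z' := t'.2.choose with hzdef'
      have hz' := t'.2.choose_spec
      rw [integral_conj_waveletSymbol_mul hΩm]
      have h2 : ∀ η ∈ Ω, conj (Real.fourierChar ⟪η, t.1⟫_ℝ : ℂ) *
          waveletSymbol Ω d.1 t'.1 ((contragredient d.1).symm η) =
          (Real.sqrt |LinearMap.det (d.1 : EuclideanSpace ℝ (Fin n) →ₗ[ℝ] _)| : ℂ)⁻¹ *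
          (conj (UnitAddTorus.mFourier z (torusProj L η)) *
            UnitAddTorus.mFourier z' (torusProj L η)) := by
        intro η hη
        simp only [waveletSymbol, cutCharacter, LinearEquiv.apply_symm_apply,
          Set.indicator_of_mem hη, Circle.smul_def, smul_eq_mul, mul_one]
        rw [← hz, ← hz', hchar, hchar]
        ring
      rw [setIntegral_congr_fun hΩm h2, integral_const_mul,
        setIntegral_conj_mFourier_mul_mFourier hL hΩm hΩ,
        mul_inv_cancel_left₀ (sqrt_abs_det_ne_zero d.1)]
      by_cases ht : t = t'
      · subst ht
        rw [if_pos rfl, if_pos rfl]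
      · rw [if_neg, if_neg]
        · simpa using ht
        · intro h
          rw [← hzdef, h] at hz
          exact ht (Subtype.ext (hz.symm.trans hz'))
    -- For different dilations the supports are disjoint almost everywhere by the uniqueness in
    -- `htile`.
    · rw [if_neg (fun h => hd (Prod.ext_iff.1 h).1)]
      refine integral_eq_zero_of_ae ?_
      filter_upwards [htile] with ξ hξ
      simp only [waveletSymbol, cutCharacter, Pi.zero_apply]
      by_cases h3 : contragredient d.1 ξ ∈ Ω
      · by_cases h4 : contragredient d'.1 ξ ∈ Ω
        · exact absurd (Subtype.ext (hξ.unique ⟨d.2, h3⟩ ⟨d'.2, h4⟩)) hd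
        · simp [h4]
      · simp [h3]
  have hcomplete : (Submodule.span ℂ (Set.range v))ᗮ = ⊥ := by
    rw [Submodule.eq_bot_iff]
    intro g hg
    have hg0 : ∀ i, inner ℂ (v i) g = 0 := fun i =>
      (Submodule.mem_orthogonal _ _).1 hg _ (Submodule.subset_span ⟨i, rfl⟩)
    -- For fixed `d`, orthogonality to all translates kills every Fourier coefficient of `g ∘ dᵀ` on
    -- `Ω`. Countably many such tiles cover almost all of space.
    have hd : ∀ d ∈ D, ∀ᵐ ξ : EuclideanSpace ℝ (Fin n), contragredient d ξ ∈ Ω → g ξ = 0 := by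
      intro d hdD
      have hgd : MemLp (fun η => g ((contragredient d).symm η)) 2 (volume.restrict Ω) :=
        ((Lp.memLp g).comp_linearEquiv (contragredient d).symm).restrict Ω
      have h0 := ae_eq_zero_of_setIntegral_mFourier_eq_zero hL hΩm hΩ hgd fun z => by
        have h1 := hg0 (⟨d, hdD⟩, ⟨_, z, rfl⟩)
        rw [hvg, integral_conj_waveletSymbol_mul hΩm] at h1
        have h2 := (mul_eq_zero.1 h1).resolve_left (sqrt_abs_det_ne_zero d)
        simpa only [hchar] using h2
      rw [Filter.EventuallyEq, ae_restrict_iff' hΩm] at h0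
      have h3 := (quasiMeasurePreserving_linearEquiv (contragredient d)).ae h0
      filter_upwards [h3] with ξ hξ h
      simpa using hξ h
    have hall := (ae_ball_iff hD).2 hd
    refine Lp.ext ?_
    filter_upwards [hall, htile, Lp.coeFn_zero ℂ 2
      (volume : Measure (EuclideanSpace ℝ (Fin n)))] with ξ h1 h2 h3
    obtain ⟨d, ⟨hdD, hdΩ⟩, -⟩ := h2
    rw [h1 d hdD hdΩ, h3]
    rfl
  let b' := HilbertBasis.mkOfOrthogonalEqBot hortho hcomplete
  have hb' : ∀ i, b' i = v i := fun i =>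
    congrFun (HilbertBasis.coe_mkOfOrthogonalEqBot hortho hcomplete) i
  let Φ := Lp.fourierTransformₗᵢ (EuclideanSpace ℝ (Fin n)) ℂ
  refine ⟨hΩm, Φ.symm (hone.toLp _), ⟨HilbertBasis.ofRepr (Φ.trans b'.repr), fun d t => ?_⟩, ?_⟩
  · have h1 : (HilbertBasis.ofRepr (Φ.trans b'.repr)) (d, t) = Φ.symm (v (d, t)) := by
      rw [← hb']
      rfl
    rw [h1]
    have h2 := fourierTransformₗᵢ_symm_toLp_ae_eq hone1 hone
    have h3 : Measure.QuasiMeasurePreserving (fun x => d.1 x + t.1)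
        (volume : Measure (EuclideanSpace ℝ (Fin n))) volume :=
      (measurePreserving_add_right volume t.1).quasiMeasurePreserving.comp
        (quasiMeasurePreserving_linearEquiv d.1)
    filter_upwards [fourierTransformₗᵢ_symm_toLp_ae_eq
      (memLp_one_iff_integrable.1 (memLp_waveletSymbol hΩm hfin d.1 t.1 1))
      (memLp_waveletSymbol hΩm hfin d.1 t.1 2), h3.ae h2] with x hx hx'
    rw [hx', ← fourierInv_waveletSymbol]
    exact hx
  · rw [LinearIsometryEquiv.apply_symm_apply]
    exact hone.coeFn_toLp

end Wavelet

/-! ### Tiling by the dilation set and conclusion -/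

section MainTheorem

theorem contragredient_mul {E : Type*} [NormedAddCommGroup E] [InnerProductSpace ℝ E]
    [FiniteDimensional ℝ E] (d e : E ≃ₗ[ℝ] E) :
    contragredient (d * e) = contragredient d * contragredient e :=
  (eq_contragredient fun x y => by
    simp only [LinearEquiv.mul_apply, inner_contragredient_apply]).symm

theorem contragredient_zpow {E : Type*} [NormedAddCommGroup E] [InnerProductSpace ℝ E]
    [FiniteDimensional ℝ E] (d : E ≃ₗ[ℝ] E) (k : ℤ) :
    contragredient (d ^ k) = contragredient d ^ k :=
  map_zpow (MonoidHom.mk' (contragredient (E := E)) contragredient_mul) d k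

variable {n : ℕ} {Δ : Set (EuclideanSpace ℝ (Fin n))}
  {α : Module.Basis (Fin n) ℝ (EuclideanSpace ℝ (Fin n))}

theorem exists_inner_coordinates (α : Module.Basis (Fin n) ℝ (EuclideanSpace ℝ (Fin n))) :
    ∃ c : EuclideanSpace ℝ (Fin n) ≃ₗ[ℝ] (Fin n → ℝ), ∀ x j, c x j = ⟪x, α j⟫_ℝ := by
  let f : EuclideanSpace ℝ (Fin n) →ₗ[ℝ] (Fin n → ℝ) :=
    LinearMap.pi fun j => (innerₗ (EuclideanSpace ℝ (Fin n))) (α j)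
  have hf : ∀ x j, f x j = ⟪x, α j⟫_ℝ := fun x j => real_inner_comm x (α j)
  have hinj : Function.Injective f := by
    rw [← LinearMap.ker_eq_bot, LinearMap.ker_eq_bot']
    intro x hx
    refine InnerProductSpace.ext_inner_right_basis (𝕜 := ℝ) α fun j => ?_
    rw [← hf, hx, inner_zero_left, Pi.zero_apply]
  exact ⟨LinearEquiv.ofInjectiveOfFinrankEq f hinj (by simp), hf⟩

theorem ae_forall_root_inner_ne_zero (hΔ : IsEuclideanRootSystem Δ) :
    ∀ᵐ x : EuclideanSpace ℝ (Fin n), ∀ β ∈ Δ, ⟪x, β⟫_ℝ ≠ 0 := by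
  refine (ae_ball_iff hΔ.finite.countable).2 fun β hβ => ?_
  have h : volume ((Submodule.span ℝ {β})ᗮ : Set (EuclideanSpace ℝ (Fin n))) = 0 := by
    refine Measure.addHaar_submodule volume _ fun htop => ?_
    have : β ∈ (Submodule.span ℝ {β})ᗮ := htop ▸ Submodule.mem_top
    rw [Submodule.mem_orthogonal_singleton_iff_inner_right] at this
    exact hΔ.ne_zero β hβ (inner_self_eq_zero.1 this)
  filter_upwards [measure_eq_zero_iff_ae_notMem.1 h] with x hx h0
  exact hx (Submodule.mem_orthogonal_singleton_iff_inner_left.2 h0)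

/-- A zero of `(w x, α i) = (x, w⁻¹ α i)` would put `x` on a root hyperplane. Thus generic points
land in the open chamber, where `W` acts freely. -/
theorem inner_pos_of_mem_fundamentalCone (hΔ : IsEuclideanRootSystem Δ)
    (hα : IsSimpleSystem Δ α)
    {w : EuclideanSpace ℝ (Fin n) ≃ₗ[ℝ] EuclideanSpace ℝ (Fin n)} (hw : w ∈ reflectionGroup Δ)
    {x : EuclideanSpace ℝ (Fin n)} (hx : ∀ β ∈ Δ, ⟪x, β⟫_ℝ ≠ 0) (hwx : w x ∈ fundamentalCone α)
    (i : Fin n) : 0 < ⟪w x, α i⟫_ℝ := by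
  refine (hwx i).lt_of_ne fun h => ?_
  have h1 : w (w⁻¹ (α i)) = α i := w.apply_symm_apply _
  rw [← h1, inner_reflectionGroup hw] at h
  exact hx _ (hΔ.reflectionGroup_apply_mem (inv_mem hw) (hα.mem i)) h.symm

theorem countable_dilationSet (hΔ : IsEuclideanRootSystem Δ)
    (B : EuclideanSpace ℝ (Fin n) ≃ₗ[ℝ] EuclideanSpace ℝ (Fin n)) :
    (dilationSet B (reflectionGroup Δ)).Countable := by
  have := hΔ.finite_reflectionGroup
  refine (Set.countable_range fun p : ℤ × reflectionGroup Δ => B ^ p.1 * p.2.1).mono ?_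
  rintro d ⟨k, w, hw, rfl⟩
  exact ⟨(k, ⟨w, hw⟩), rfl⟩

/-- A tile of the fundamental cone under the powers of the expansion dual to `B` is a tile of the
space under the contragredients of the dilation set. -/
theorem ae_existsUnique_dilationSet [NeZero n] (hΔ : IsEuclideanRootSystem Δ)
    (hα : IsSimpleSystem Δ α) {a : Fin n → ℝ} (ha : ∀ j, 1 < a j)
    {B A : EuclideanSpace ℝ (Fin n) ≃ₗ[ℝ] EuclideanSpace ℝ (Fin n)}
    (hBA : A = (contragredient B)⁻¹)
    {c : EuclideanSpace ℝ (Fin n) ≃ₗ[ℝ] (Fin n → ℝ)} (hc : ∀ x j, c x j = ⟪x, α j⟫_ℝ)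
    (hA : ∀ x j, c (A x) j = a j * c x j) {Ω : Set (EuclideanSpace ℝ (Fin n))}
    (hΩ : Ω ⊆ fundamentalCone α)
    (htile : ∀ x ∈ fundamentalCone α, x ≠ 0 → ∃! k : ℤ, (A ^ k) x ∈ Ω) :
    ∀ᵐ x : EuclideanSpace ℝ (Fin n),
      ∃! d, d ∈ dilationSet B (reflectionGroup Δ) ∧ contragredient d x ∈ Ω := by
  have hcon : ∀ (k : ℤ), ∀ w ∈ reflectionGroup Δ, ∀ x,
      contragredient (B ^ k * w) x = (A ^ (-k)) (w x) := by
    intro k w hw x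
    have h1 : contragredient w = w := (eq_contragredient (inner_reflectionGroup hw)).symm
    rw [contragredient_mul, contragredient_zpow, h1, hBA, inv_zpow', neg_neg,
      LinearEquiv.mul_apply]
  filter_upwards [ae_forall_root_inner_ne_zero hΔ] with x hx
  obtain ⟨w, hw, hwx⟩ := hα.exists_mem_fundamentalCone hΔ
    (ρ := c.symm fun _ => 1) (fun i => by rw [← hc, c.apply_symm_apply]; exact one_pos) x
  have hwpos := inner_pos_of_mem_fundamentalCone hΔ hα hw hx hwx
  have hwx0 : w x ≠ 0 := fun h => by
    have := hwpos 0
    rw [h, inner_zero_left] at this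
    exact this.false
  obtain ⟨k, hk, huniq⟩ := htile (w x) hwx hwx0
  refine ⟨B ^ (-k) * w, ⟨⟨-k, w, hw, rfl⟩, ?_⟩, ?_⟩
  · rwa [hcon _ w hw, neg_neg]
  · rintro d ⟨⟨l, u, hu, rfl⟩, hd⟩
    rw [hcon l u hu] at hd
    -- `A` scales the cone coordinates by positive factors, so `u x` is in the cone as soon as some
    -- `A^k (u x)` is. Freeness then gives `u = w`.
    have hux : u x ∈ fundamentalCone α := fun j => by
      have h1 := hΩ hd j
      rw [← hc, coord_zpow_apply ha hA, hc] at h1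
      exact nonneg_of_mul_nonneg_right h1 (zpow_pos (zero_lt_one.trans (ha j)) _)
    have hupos := inner_pos_of_mem_fundamentalCone hΔ hα hu hx hux
    have h2 : u * w⁻¹ = 1 := by
      refine hα.eq_one_of_mem_chamber hΔ (mul_mem hu (inv_mem hw)) hwpos fun i => ?_
      have h3 : w⁻¹ (w x) = x := w.symm_apply_apply x
      rw [LinearEquiv.mul_apply, h3]
      exact hupos i
    obtain rfl : u = w := mul_inv_eq_one.1 h2
    rw [← huniq _ hd, neg_neg]

/-- Pairing with `αstar i` reads off the `i`-th coordinate in the basis `α`, and the adjoint moves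
`A` onto its eigenvector `αstar i`. -/
theorem apply_basis_of_dual (αstar : Fin n → EuclideanSpace ℝ (Fin n))
    (hαstar : ∀ i j, ⟪α i, αstar j⟫_ℝ = if i = j then 1 else 0)
    {a : Fin n → ℝ} {A B : EuclideanSpace ℝ (Fin n) →ₗ[ℝ] EuclideanSpace ℝ (Fin n)}
    (hA : ∀ j, A (αstar j) = a j • αstar j) (hB : B = LinearMap.adjoint A) (j : Fin n) :
    B (α j) = a j • α j := by
  have hrepr : ∀ x i, α.repr x i = ⟪x, αstar i⟫_ℝ := fun x i => by
    conv_rhs => rw [← α.sum_repr x, sum_inner]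
    simp only [inner_smul_left, hαstar]
    simp
  refine α.repr.injective (Finsupp.ext fun i => ?_)
  rw [hrepr, hrepr, hB, LinearMap.adjoint_inner_left, hA, inner_smul_right, inner_smul_left,
    hαstar]
  by_cases h : j = i
  · simp [h]
  · simp [h]

theorem mainTheorem4 {n : ℕ}
    (Δ : Set (EuclideanSpace ℝ (Fin n))) (hΔ : IsEuclideanRootSystem Δ)
    (α : Module.Basis (Fin n) ℝ (EuclideanSpace ℝ (Fin n))) (hα : IsSimpleSystem Δ α)
    (αstar : Fin n → EuclideanSpace ℝ (Fin n))
    (hαstar : ∀ i j, ⟪α i, αstar j⟫_ℝ = if i = j then 1 else 0)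
    (a : Fin n → ℝ) (ha : ∀ j, 1 < a j)
    (A : EuclideanSpace ℝ (Fin n) →ₗ[ℝ] EuclideanSpace ℝ (Fin n))
    (hA : ∀ j, A (αstar j) = a j • αstar j)
    (B : EuclideanSpace ℝ (Fin n) ≃ₗ[ℝ] EuclideanSpace ℝ (Fin n))
    (hB : (B : EuclideanSpace ℝ (Fin n) →ₗ[ℝ] EuclideanSpace ℝ (Fin n)) = LinearMap.adjoint A)
    (G : Matrix (Fin n) (Fin n) ℝ) (hG : G.det = 1) :
    ∃ Ω : Set (EuclideanSpace ℝ (Fin n)),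
      Ω ⊆ fundamentalCone α ∧
        IsWaveletSet (dilationSet B (reflectionGroup Δ)) (latticeOf G) Ω := by
  obtain ⟨L, hL, hchar⟩ := exists_lattice_coordinates hG
  have hD := countable_dilationSet hΔ B
  rcases eq_or_ne n 0 with rfl | hn
  -- In dimension zero the shell is empty, but the single point already tiles.
  · have : Subsingleton (EuclideanSpace ℝ (Fin 0)) := L.injective.subsingleton
    refine ⟨Set.univ, fun x _ i => i.elim0, isWaveletSet_of_tiling hD hL hchar MeasurableSet.univ
      ⟨fun _ _ => Set.mem_univ _, fun x _ y _ _ => Subsingleton.elim x y,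
        fun t _ => ⟨0, Set.mem_univ _, Subsingleton.elim _ _⟩⟩
      (Filter.Eventually.of_forall fun x => ⟨1, ⟨⟨0, 1, one_mem _, by simp⟩, Set.mem_univ _⟩,
        fun d _ => LinearEquiv.ext fun y => Subsingleton.elim _ _⟩)⟩
  · have : NeZero n := ⟨hn⟩
    obtain ⟨c, hc⟩ := exists_inner_coordinates α
    have hBα : ∀ j, B (α j) = a j • α j := apply_basis_of_dual αstar hαstar hA hB
    -- Here `(contragredient B)⁻¹ = Bᵀ` plays the role of `A` as an invertible map.
    have hA' : ∀ x j, c ((contragredient B)⁻¹ x) j = a j * c x j := by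
      intro x j
      have h1 : contragredient B ((contragredient B)⁻¹ x) = x :=
        (contragredient B).apply_symm_apply x
      rw [hc, hc, ← inner_contragredient_apply B, h1, hBα, inner_smul_right]
    have hcone : fundamentalCone α = {x | ∀ j, 0 ≤ c x j} := by
      simp only [fundamentalCone, hc]
    obtain ⟨Ω, hΩm, hΩC, htile, hΩ⟩ := exists_orthant_tile ha hA' L
    rw [← hcone] at hΩC
    refine ⟨Ω, hΩC, isWaveletSet_of_tiling hD hL hchar hΩm hΩ
      (ae_existsUnique_dilationSet hΔ hα ha rfl hc hA' hΩC fun x hx hx0 => htile x ?_ hx0)⟩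
    rwa [hcone] at hx

end MainTheorem
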